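/- Let $G=(V,E)$ be a connected simple graph with $\sup_{v\in V}\deg(v)=d<\infty$. Let $\Gamma\subset\mathrm{Aut}(G)$ be a subgroup and $S\subset V$ a set such that, with $E_S=\{e\in E: e\subset S\}$, the graph $(S,E_S)$ is connected, every $g\in\Gamma$ satisfies $g(S)=S$, and $\Gamma|_S$ acts transitively on $S$. For $p,q\in[0,1]$ let $P_{p,q}$ be the bond percolation measure on $\{0,1\}^E$ under which the edges are independent, each edge of $E_S$ is open with probability $q$ and each edge of $E\setminus E_S$ is open with probability $p$. Let $\mathcal C(v)$ be the open cluster of $v$, let $\{v\leftrightarrow\infty\}$ be the event $|\mathcal C(v)|=\infty$, and let $N_\infty$ be the number of infinite open clusters. Fix $o\in S$ and put $$q_c(p)=\sup\{q\in[0,1]:P_{p,q}(o\leftrightarrow\infty)=0\}\qquad(\sup\emptyset=0),$$ and let $p_c(S,E_S)$ be the supremum of those $r\in[0,1]$ for which, in homogeneous Bernoulli bond percolation with parameter $r$ on the graph $(S,E_S)$, the cluster of $o$ is almost surely finite. Suppose that $(S,E_S)$ is amenable, i.e. for every $\varepsilon>0$ there is a finite nonempty $K\subset S$ such that at most $\varepsilon|K|$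 vertices of $K$ have an $E_S$-neighbour in $S\setminus K$, and that $0<p_c(S,E_S)<1$. Let $p\in(0,1)$ and $q\in[0,1]$ with $q>q_c(d^{-2})$ be such that $$P_{p,q}(v\leftrightarrow\infty)>0\ \text{ for some } v\in V,\qquad P_{p,q}\big(|\mathcal C(v)|=\infty,\ |\mathcal C(v)\cap S|<\infty\big)=0\ \text{ for all } v\in V.$$ Then $P_{p,q}(N_\infty=1)=1$. -/

import Mathlib

open MeasureTheory ProbabilityTheory
open scoped unitInterval

noncomputable section

namespace Percolation

universe u

variable {V : Type u}

/-- A bond configuration of `G`: each edge is open (`true`) or closed (`false`). The space of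
configurations carries the product (cylinder) sigma-algebra. -/
abbrev Config (G : SimpleGraph V) : Type u := G.edgeSet → Bool

/-- The subgraph of `G` (on all vertices) formed by the open edges of `ω`. -/
def openGraph (G : SimpleGraph V) (ω : Config G) : SimpleGraph V where
  Adj x y := ∃ h : G.Adj x y, ω ⟨s(x, y), h⟩ = true
  symm := ⟨by
    rintro x y ⟨h, hω⟩
    refine ⟨h.symm, ?_⟩
    rw [← hω]
    congr 2
    exact Sym2.eq_swap⟩
  loopless := ⟨fun x h => G.loopless.irrefl x h.1⟩

/-- The open cluster of `v`. -/
def cluster (G : SimpleGraph V) (ω : Config G) (v : V) : Set V :=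
  {w | (openGraph G ω).Reachable v w}

/-- The number of infinite clusters, with values in `ℕ ∪ {∞}`. -/
def numInfiniteClusters (G : SimpleGraph V) (ω : Config G) : ℕ∞ :=
  {C : Set V | C.Infinite ∧ ∃ v, C = cluster G ω v}.encard

/-- The event that `v` lies in an infinite cluster. -/
def percolates (G : SimpleGraph V) (v : V) : Set (Config G) :=
  {ω | (cluster G ω v).Infinite}

/-- Independent bond percolation in which the edge `e` is open with probability `r e`. -/
def bondMeasure (G : SimpleGraph V) (r : G.edgeSet → I) : Measure (Config G) :=
  Measure.infinitePi fun e => bernoulliMeasure true false (r e)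

open Classical in
/-- The inhomogeneous Bernoulli bond percolation measure `P_{p,q}`: edges with both endpoints in
`S` are open with probability `q`, all other edges with probability `p`. -/
def inhomMeasure (G : SimpleGraph V) (S : Set V) (p q : I) : Measure (Config G) :=
  bondMeasure G fun e => if ∀ x ∈ (e : Sym2 V), x ∈ S then q else p

/-- The critical parameter of homogeneous Bernoulli bond percolation on `G`, seen from `o`. -/
def critProb (G : SimpleGraph V) (o : V) : I :=
  sSup {p : I | bondMeasure G (fun _ => p) (percolates G o) = 0}

/-- The critical parameter function `p ↦ q_c(p)` of `P_{p,q}`, seen from `o`. -/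
def critFun (G : SimpleGraph V) (S : Set V) (o : V) (p : I) : I :=
  sSup {q : I | inhomMeasure G S p q (percolates G o) = 0}

/-- The parameter `d⁻²`. -/
def invSq (d : ℕ) : I :=
  ⟨((d : ℝ) ^ 2)⁻¹, by positivity, by
    rcases Nat.eq_zero_or_pos d with rfl | h
    · simp
    · exact inv_le_one_of_one_le₀ (one_le_pow₀ (by exact_mod_cast h))⟩

/-- The interior vertex boundary of `K`: vertices of `K` with a neighbour outside `K`. -/
def innerBoundary (G : SimpleGraph V) (K : Set V) : Set V :=
  {y | y ∈ K ∧ ∃ x, x ∉ K ∧ G.Adj x y}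

/-- Amenability of a graph: finite nonempty vertex sets `K` exist with `|∂K| / |K|` arbitrarily
small. -/
def IsAmenable (G : SimpleGraph V) : Prop :=
  ∀ ε : ℝ, 0 < ε → ∃ K : Finset V, K.Nonempty ∧
    ((innerBoundary G (K : Set V)).ncard : ℝ) ≤ ε * (K.card : ℝ)

/-- The group `Γ` of automorphisms of `G` preserves `S`, and its restriction to `S` acts
transitively on the subgraph induced by `S`. -/
def ActsTransitivelyOn {G : SimpleGraph V} (Γ : Subgroup (G ≃g G)) (S : Set V) : Prop :=
  (∀ g ∈ Γ, (fun v => g v) '' S = S) ∧ ∀ u ∈ S, ∀ v ∈ S, ∃ g ∈ Γ, g u = v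

end Percolation

end

/-! For small p the edges outside `S` only decorate the amenable graph on `S` with connections of
tight range, and uniqueness follows as in Burton and Keane. Larger parameters are reached by
sprinkling.

If dp < 1, which holds when p < 1 and p ≤ d⁻², counting trails shows that clusters formed by open
edges outside E_S are finite (`ae_finite_offGraph_component`), so every infinite cluster meets `S`
infinitely often. Call a fully open ball of `S` a trifurcation when its removal leaves three
infinite branches attached to it. Inside a finite K ⊂ S, disjoint trifurcations number at most twice
the points of K that are near the boundary of K or have a far-reaching off-`S` cluster
(`card_trifurcations_le`, from the deterministic `card_le_card_of_trifurcations`). Amenability makes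
such points rare, so trifurcations have probability zero. Since all edges of a finite ball of `S`
can be opened, three infinite clusters would create a trifurcation, and exactly two would merge into
a unique one. With the zero-one law, percolation forces uniqueness
(`ae_hasUniqueInfinite_of_finite_off`).

If p > d⁻², choose q₀ with q_c(d⁻²) < q₀ < q. At (d⁻², q₀) there is percolation, hence uniqueness.
The (p, q) configuration is the union of this one and an independent sprinkling of positive density
on every edge (`measurePreserving_union`). An infinite cluster C of the union meets `S` infinitely
often by hypothesis, and a point of C ∩ S lies within some distance m of the old infinite cluster. A
double count using amenability shows that C has infinitely many points within distance m
(`ae_infinite_inter_of_mem`). Sprinkled edges then lower m one unit at a time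
(`ae_infinite_inter_of_sprinkling`) until C meets the old infinite cluster. All infinite clusters
therefore coincide (`ae_hasUniqueInfinite_of_lt`). -/

namespace Percolation

-- Deterministic graph theory: vertex removal and the trifurcation count

universe u

variable {V : Type u}

/-- The graph obtained from `H` by isolating the vertices of `J`. -/
def avoid (H : SimpleGraph V) (J : Set V) : SimpleGraph V where
  Adj a b := H.Adj a b ∧ a ∉ J ∧ b ∉ J
  symm := ⟨fun _ _ h => ⟨h.1.symm, h.2.2, h.2.1⟩⟩
  loopless := ⟨fun x h => H.loopless.irrefl x h.1⟩

/-- The vertex set of the connected component of `v`. -/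
def component (H : SimpleGraph V) (v : V) : Set V := {w | H.Reachable v w}

lemma avoid_le (H : SimpleGraph V) (J : Set V) : avoid H J ≤ H := fun _ _ h => h.1

lemma component_eq {H : SimpleGraph V} {u v : V} (h : H.Reachable u v) :
    component H u = component H v :=
  Set.ext fun _ => ⟨fun hw => h.symm.trans hw, fun hw => h.trans hw⟩

lemma component_mono {H H' : SimpleGraph V} (h : H ≤ H') (v : V) :
    component H v ⊆ component H' v := fun _ hw => SimpleGraph.Reachable.mono h hw

lemma reachable_induction {H : SimpleGraph V} {v : V} {P : V → Prop} (h0 : P v)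
    (hs : ∀ a b, H.Reachable v a → P a → H.Adj a b → P b) {w : V} (hw : H.Reachable v w) : P w := by
  rw [SimpleGraph.reachable_iff_reflTransGen] at hw
  induction hw with
  | refl => exact h0
  | tail hab hbc ih =>
    exact hs _ _ ((SimpleGraph.reachable_iff_reflTransGen _ _).2 hab) ih hbc

lemma notMem_of_reachable_avoid {H : SimpleGraph V} {J : Set V} {a b : V}
    (h : (avoid H J).Reachable a b) (ha : a ∉ J) : b ∉ J :=
  reachable_induction (H := avoid H J) (P := fun b => b ∉ J) ha (fun _ _ _ _ hxy => hxy.2.2) h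

/-- By local finiteness, removing finitely many vertices of a component leaves finitely many pieces:
each contains `v` or a neighbour of a removed vertex. One of them inherits infinitely many points of
`X`. -/
lemma exists_infinite_component_avoid {H : SimpleGraph V} (hlf : ∀ v, (H.neighborSet v).Finite)
    {v : V} {X J : Set V} (hX : (component H v ∩ X).Infinite)
    (hJ : (component H v ∩ J).Finite) :
    ∃ u ∈ component H v, u ∉ J ∧ (u = v ∨ ∃ j ∈ J, H.Adj j u) ∧
      (component (avoid H J) u ∩ X).Infinite := by
  by_contra hcon
  push Not at hcon
  set U : Set V := ({v} ∪ ⋃ j ∈ component H v ∩ J, H.neighborSet j) ∩ Jᶜ with hU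
  have hUfin : U.Finite :=
    ((Set.finite_singleton v).union (hJ.biUnion fun j _ => hlf j)).inter_of_left _
  have hcover : ∀ w, H.Reachable v w → w ∈ J ∨ ∃ u ∈ U, (avoid H J).Reachable u w := by
    intro w hw
    refine reachable_induction (P := fun w => w ∈ J ∨ ∃ u ∈ U, (avoid H J).Reachable u w) ?_ ?_ hw
    · by_cases hv : v ∈ J
      · exact Or.inl hv
      · exact Or.inr ⟨v, ⟨Or.inl rfl, hv⟩, SimpleGraph.Reachable.refl _⟩
    · intro a b hva ha hab
      by_cases hb : b ∈ J
      · exact Or.inl hb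
      right
      by_cases haJ : a ∈ J
      · refine ⟨b, ⟨Or.inr ?_, hb⟩, SimpleGraph.Reachable.refl _⟩
        exact Set.mem_biUnion (show a ∈ component H v ∩ J from ⟨hva, haJ⟩) hab
      · obtain ⟨u, hu, hua⟩ := ha.resolve_left haJ
        exact ⟨u, hu, hua.trans (SimpleGraph.Adj.reachable ⟨hab, haJ, hb⟩)⟩
  have hUc : ∀ u ∈ U, u ∈ component H v := by
    rintro u ⟨hu | hu, -⟩
    · rw [hu]; exact SimpleGraph.Reachable.refl _
    · obtain ⟨j, hj, hju⟩ := Set.mem_iUnion₂.1 hu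
      exact hj.1.trans (SimpleGraph.Adj.reachable hju)
  have hfin : ((component H v ∩ J) ∪ ⋃ u ∈ U, component (avoid H J) u ∩ X).Finite := by
    refine hJ.union (hUfin.biUnion fun u hu => ?_)
    refine hcon u (hUc u hu) hu.2 ?_
    rcases hu.1 with h | h
    · exact Or.inl h
    · obtain ⟨j, hj, hju⟩ := Set.mem_iUnion₂.1 h
      exact Or.inr ⟨j, hj.2, hju⟩
  refine hX (hfin.subset ?_)
  rintro w ⟨hw, hwX⟩
  rcases hcover w hw with h | ⟨u, hu, huw⟩
  · exact Or.inl ⟨hw, h⟩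
  · exact Or.inr (Set.mem_biUnion hu ⟨huw, hwX⟩)

/-- A path from `z` to `B`, stopped when it first hits `B`, cannot have met `A`. -/
lemma reachable_avoid_of_not_reachable {H : SimpleGraph V} {A B : Set V} (hAB : Disjoint A B)
    {z w : V} (hzB : z ∉ B) (hw : w ∈ B) (hzw : H.Reachable z w)
    (h : ∀ a ∈ A, ¬ (avoid H B).Reachable z a) : ∃ b ∈ B, (avoid H A).Reachable z b := by
  obtain ⟨p⟩ := hzw
  induction p with
  | nil => exact absurd hw hzB
  | @cons x y w' hxy p ih =>
    have hxA : x ∉ A := fun hx => h x hx (SimpleGraph.Reachable.refl _)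
    by_cases hy : y ∈ B
    · exact ⟨y, hy, SimpleGraph.Adj.reachable
        ⟨hxy, hxA, fun hyA => Set.disjoint_left.1 hAB hyA hy⟩⟩
    · have hadj : (avoid H B).Adj x y := ⟨hxy, hzB, hy⟩
      have hyn : ∀ a ∈ A, ¬ (avoid H B).Reachable y a := fun a ha hya =>
        h a ha (hadj.reachable.trans hya)
      obtain ⟨b, hb, hyb⟩ := ih hy hw hyn
      have hyA : y ∉ A := fun hx => hyn y hx (SimpleGraph.Reachable.refl _)
      exact ⟨b, hb, (SimpleGraph.Adj.reachable (G := avoid H A) ⟨hxy, hxA, hyA⟩).trans hyb⟩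

/-- Disjoint connected sets, each of which separates three points of `Y` when removed, are at
most as numerous as the points of `Y`. -/
lemma card_le_card_of_trifurcations {ι : Type*} {H : SimpleGraph V} (W : ι → Set V)
    (n : ℕ) (s : Finset ι) (hn : s.card = n) (Y : Finset V)
    (hdisj : ∀ i ∈ s, ∀ j ∈ s, i ≠ j → Disjoint (W i) (W j))
    (hne : ∀ i ∈ s, (W i).Nonempty)
    (hconn : ∀ i ∈ s, ∀ J, Disjoint (W i) J → ∀ a ∈ W i, ∀ b ∈ W i, (avoid H J).Reachable a b)
    (hbr : ∀ i ∈ s, ∃ f : Fin 3 → V,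
      (∀ k, f k ∈ Y ∧ f k ∉ W i ∧ ∃ w ∈ W i, H.Reachable (f k) w) ∧
      ∀ k l, k ≠ l → ¬ (avoid H (W i)).Reachable (f k) (f l)) :
    s.card ≤ Y.card := by
  classical
  induction n generalizing s Y with
  | zero => omega
  | succ n ih =>
    -- An extremal choice replaces the tree structure. The pair (i, y₀) maximises the number of sets
    -- `W j` reachable from y₀ after removal of `W i`, so that `W i` is extremal as seen from y₀.
    let cnt : ι × V → ℕ := fun q =>
      (s.filter fun j => ∃ w ∈ W j, (avoid H (W q.1)).Reachable q.2 w).card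
    let att : ι × V → Prop := fun q => q.2 ∉ W q.1 ∧ ∃ w ∈ W q.1, H.Reachable q.2 w
    have hsne : s.Nonempty := by rw [← Finset.card_pos]; omega
    have hPne : ((s ×ˢ Y).filter att).Nonempty := by
      obtain ⟨i, hi⟩ := hsne
      obtain ⟨f, hf, -⟩ := hbr i hi
      exact ⟨(i, f 0), Finset.mem_filter.2
        ⟨Finset.mem_product.2 ⟨hi, (hf 0).1⟩, (hf 0).2⟩⟩
    obtain ⟨⟨i, y0⟩, hq, hmax⟩ := Finset.exists_max_image _ cnt hPne
    obtain ⟨hq1, hy0W, w0, hw0, hy0w0⟩ := Finset.mem_filter.1 hq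
    obtain ⟨his, hy0Y⟩ := Finset.mem_product.1 hq1
    dsimp only at his hy0Y hy0W hw0 hy0w0
    have hH : ∀ i ∈ s, ∀ a ∈ W i, ∀ b ∈ W i, H.Reachable a b := fun i hi a ha b hb =>
      (hconn i hi ∅ (Set.disjoint_empty _) a ha b hb).mono (avoid_le H ∅)
    -- Branches at `W i` other than that of y₀ contain no further `W j`. Otherwise, after removing
    -- `W j` instead, y₀ would still reach every set counted for `W i`, and `W i` as well, against
    -- maximality.
    have hleaf : ∀ y ∉ W i, (∃ w ∈ W i, H.Reachable y w) → ¬ (avoid H (W i)).Reachable y y0 →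
        ∀ j ∈ s, j ≠ i → ∀ w ∈ W j, ¬ (avoid H (W i)).Reachable y w := by
      rintro y hy ⟨wy, hwy, hywy⟩ hyy0 j hj hji w hw hyw
      have hd := hdisj i his j hj hji.symm
      have hno : ∀ b ∈ W j, ¬ (avoid H (W i)).Reachable y0 b := fun b hb hyb =>
        hyy0 (hyw.trans ((hconn j hj _ hd.symm w hw b hb).trans hyb.symm))
      have key : ∀ z ∉ W i, (avoid H (W i)).Reachable y0 z →
          ∃ b ∈ W i, (avoid H (W j)).Reachable z b := fun z hz hyz =>
        reachable_avoid_of_not_reachable hd.symm hz hw0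
          ((hyz.mono (avoid_le _ _)).symm.trans hy0w0) fun b hb hzb => hno b hb (hyz.trans hzb)
      obtain ⟨b0, hb0, hy0b0⟩ := key y0 hy0W (SimpleGraph.Reachable.refl _)
      have hy0j : y0 ∉ W j := fun h => hno y0 h (SimpleGraph.Reachable.refl _)
      have hwi : ∃ w' ∈ W j, H.Reachable y0 w' :=
        ⟨w, hw, (hy0w0.trans (hH i his _ hw0 _ hwy)).trans
          (hywy.symm.trans (hyw.mono (avoid_le _ _)))⟩
      have hlt : cnt (i, y0) < cnt (j, y0) := by
        apply Finset.card_lt_card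
        rw [Finset.ssubset_iff_of_subset]
        · refine ⟨i, Finset.mem_filter.2 ⟨his, b0, hb0, hy0b0⟩, fun h => ?_⟩
          obtain ⟨-, b, hb, hyb⟩ := Finset.mem_filter.1 h
          exact notMem_of_reachable_avoid hyb hy0W hb
        · intro k hk
          obtain ⟨hks, wk, hwk, hyk⟩ := Finset.mem_filter.1 hk
          obtain ⟨b, hb, hkb⟩ := key wk (notMem_of_reachable_avoid hyk hy0W) hyk
          exact Finset.mem_filter.2 ⟨hks, wk, hwk,
            hy0b0.trans ((hconn i his _ hd b0 hb0 b hb).trans hkb.symm)⟩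
      exact absurd (hmax (j, y0) (Finset.mem_filter.2 ⟨Finset.mem_product.2 ⟨hj, hy0Y⟩,
        hy0j, hwi⟩)) (not_le.2 hlt)
    obtain ⟨f, hf, hfn⟩ := hbr i his
    -- At most one of the three branches is that of y₀, so two branches are free of other sets. The
    -- induction discards `W i` together with the point `f k₁`.
    obtain ⟨k₁, k₂, hk, h1, h2⟩ : ∃ k₁ k₂, k₁ ≠ k₂ ∧ ¬ (avoid H (W i)).Reachable (f k₁) y0 ∧
        ¬ (avoid H (W i)).Reachable (f k₂) y0 := by
      by_cases h0 : (avoid H (W i)).Reachable (f 0) y0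
      · exact ⟨1, 2, by decide, fun h => hfn 1 0 (by decide) (h.trans h0.symm),
          fun h => hfn 2 0 (by decide) (h.trans h0.symm)⟩
      by_cases h1 : (avoid H (W i)).Reachable (f 1) y0
      · exact ⟨0, 2, by decide, h0, fun h => hfn 2 1 (by decide) (h.trans h1.symm)⟩
      · exact ⟨0, 1, by decide, h0, h1⟩
    have hl1 := hleaf _ (hf k₁).2.1 (hf k₁).2.2 h1
    have hl2 := hleaf _ (hf k₂).2.1 (hf k₂).2.2 h2
    have hne12 : f k₁ ≠ f k₂ := fun h => hfn k₁ k₂ hk (by rw [h])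
    have hcard := ih (s.erase i) (by rw [Finset.card_erase_of_mem his]; omega) (Y.erase (f k₁))
      (fun a ha b hb => hdisj a (Finset.mem_of_mem_erase ha) b (Finset.mem_of_mem_erase hb))
      (fun a ha => hne a (Finset.mem_of_mem_erase ha))
      (fun a ha => hconn a (Finset.mem_of_mem_erase ha)) ?_
    · rw [Finset.card_erase_of_mem his, Finset.card_erase_of_mem (hf k₁).1] at hcard
      have := Finset.card_pos.2 ⟨_, (hf k₁).1⟩
      omega
    intro j hj
    obtain ⟨hji, hjs⟩ := Finset.mem_erase.1 hj
    have hd := hdisj i his j hjs hji.symm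
    obtain ⟨g, hg, hgn⟩ := hbr j hjs
    by_cases hex : ∃ k, g k = f k₁
    swap
    · push Not at hex
      exact ⟨g, fun k => ⟨Finset.mem_erase.2 ⟨hex k, (hg k).1⟩, (hg k).2⟩, hgn⟩
    obtain ⟨k₀, hk₀⟩ := hex
    have hf2j : f k₂ ∉ W j := fun h => hl2 j hjs hji _ h (SimpleGraph.Reachable.refl _)
    have hf1j : f k₁ ∉ W j := fun h => hl1 j hjs hji _ h (SimpleGraph.Reachable.refl _)
    have hreach : ∀ k, (∀ b ∈ W j, ¬ (avoid H (W i)).Reachable (f k) b) →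
        ∃ b ∈ W i, (avoid H (W j)).Reachable (f k) b := fun k h => by
      obtain ⟨-, h2, w, hw, h3⟩ := hf k
      exact reachable_avoid_of_not_reachable hd.symm h2 hw h3 h
    obtain ⟨b₁, hb₁, hr₁⟩ := hreach k₁ (hl1 j hjs hji)
    obtain ⟨b₂, hb₂, hr₂⟩ := hreach k₂ (hl2 j hjs hji)
    have hr : (avoid H (W j)).Reachable (f k₁) (f k₂) :=
      hr₁.trans ((hconn i his _ hd _ hb₁ _ hb₂).trans hr₂.symm)
    -- A remaining `W j` that used `f k₁` may use `f k₂` instead: the two are joined through `W i`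
    -- without touching `W j`, hence lie in the same branch at `W j`.
    let τ : V → V := fun y => if y = f k₁ then f k₂ else y
    have hτ : ∀ y, (avoid H (W j)).Reachable (τ y) y := by
      intro y
      by_cases hy : y = f k₁
      · simp only [τ, if_pos hy]; rw [hy]; exact hr.symm
      · simp only [τ, if_neg hy]; exact SimpleGraph.Reachable.refl _
    refine ⟨fun k => τ (g k), fun k => ?_, fun k l hkl h => ?_⟩
    · obtain ⟨h1, h2, w, hw, h3⟩ := hg k
      by_cases hy : g k = f k₁
      · simp only [τ, if_pos hy]
        refine ⟨Finset.mem_erase.2 ⟨hne12.symm, (hf k₂).1⟩, hf2j, w, hw, ?_⟩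
        rw [hy] at h3
        exact (hr.mono (avoid_le _ _)).symm.trans h3
      · simp only [τ, if_neg hy]
        exact ⟨Finset.mem_erase.2 ⟨hy, h1⟩, h2, w, hw, h3⟩
    · exact hgn k l hkl ((hτ _).symm.trans (h.trans (hτ _)))

end Percolation

/-! ### Balls in `S`, transitivity and amenability -/

namespace Percolation

universe u

variable {V : Type u}

/-- The ball of radius `n` around `x` for the graph distance of the subgraph induced by `S`. -/
def sball (G : SimpleGraph V) (S : Set V) (x : V) : ℕ → Set V
  | 0 => {x}
  | n + 1 => {y | y ∈ sball G S x n ∨ y ∈ S ∧ ∃ z ∈ sball G S x n, G.Adj z y}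

/-- Automorphisms of `G` that preserve `S` act transitively on `S`. -/
def TransitiveOn (G : SimpleGraph V) (S : Set V) : Prop :=
  ∀ u ∈ S, ∀ v ∈ S, ∃ g : G ≃g G, (∀ w, g w ∈ S ↔ w ∈ S) ∧ g u = v

lemma ActsTransitivelyOn.transitiveOn {G : SimpleGraph V} {Γ : Subgroup (G ≃g G)} {S : Set V}
    (h : ActsTransitivelyOn Γ S) : TransitiveOn G S := by
  intro u hu v hv
  obtain ⟨g, hg, hgu⟩ := h.2 u hu v hv
  refine ⟨g, fun w => ?_, hgu⟩
  conv_lhs => rw [← h.1 g hg]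
  constructor
  · rintro ⟨x, hx, hxw⟩
    rwa [← g.injective hxw]
  · exact fun hw => ⟨w, hw, rfl⟩

section Balls

variable {G : SimpleGraph V} {S : Set V}

lemma sball_mono (x : V) : Monotone (sball G S x) :=
  monotone_nat_of_le_succ fun _ _ h => Or.inl h

lemma self_mem_sball (x : V) (n : ℕ) : x ∈ sball G S x n := sball_mono x (Nat.zero_le n) rfl

lemma sball_subset {x : V} (hx : x ∈ S) (n : ℕ) : sball G S x n ⊆ S := by
  induction n with
  | zero => rintro y rfl; exact hx
  | succ n ih => rintro y (hy | hy); exacts [ih hy, hy.1]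

lemma finite_sball (hlf : ∀ v, (G.neighborSet v).Finite) (x : V) (n : ℕ) :
    (sball G S x n).Finite := by
  induction n with
  | zero => exact Set.finite_singleton x
  | succ n ih =>
    refine (ih.union (ih.biUnion fun z _ => hlf z)).subset ?_
    rintro y (hy | ⟨-, z, hz, hzy⟩)
    · exact Or.inl hy
    · exact Or.inr (Set.mem_biUnion hz hzy)

lemma sball_trans {x y z : V} {n m : ℕ} (hy : y ∈ sball G S x n) (hz : z ∈ sball G S y m) :
    z ∈ sball G S x (n + m) := by
  induction m generalizing z with
  | zero => rw [show z = y from hz]; exact hy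
  | succ m ih =>
    rcases hz with hz | ⟨hzS, w, hw, hwz⟩
    · exact Or.inl (ih hz)
    · exact Or.inr ⟨hzS, w, ih hw, hwz⟩

lemma mem_sball_symm {x y : V} {n : ℕ} (hx : x ∈ S) (hy : y ∈ sball G S x n) :
    x ∈ sball G S y n := by
  induction n generalizing y with
  | zero => exact (show y = x from hy).symm
  | succ n ih =>
    rcases hy with hy | ⟨hyS, z, hz, hzy⟩
    · exact Or.inl (ih hy)
    · rw [add_comm]
      refine sball_trans ?_ (ih hz)
      exact Or.inr ⟨sball_subset hx n hz, y, rfl, hzy.symm⟩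

lemma exists_mem_sball (hS : (G.induce S).Connected) {x y : V} (hx : x ∈ S) (hy : y ∈ S) :
    ∃ n, y ∈ sball G S x n := by
  have h := hS.preconnected ⟨x, hx⟩ ⟨y, hy⟩
  refine reachable_induction (P := fun w : S => ∃ n, (w : V) ∈ sball G S x n)
    ⟨0, self_mem_sball x 0⟩ ?_ h
  rintro a b - ⟨n, hn⟩ hab
  exact ⟨n + 1, Or.inr ⟨b.2, a, hn, hab⟩⟩

lemma countable_of_connected (hG : G.Connected) (hlf : ∀ v, (G.neighborSet v).Finite) :
    Countable V := by
  obtain ⟨o⟩ := hG.nonempty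
  rw [← Set.countable_univ_iff]
  refine (Set.countable_iUnion fun n => (finite_sball (S := Set.univ) hlf o n).countable).mono ?_
  intro y _
  refine Set.mem_iUnion.2 (reachable_induction (P := fun w => ∃ n, w ∈ sball G Set.univ o n)
    ⟨0, rfl⟩ ?_ (hG.preconnected o y))
  rintro a b - ⟨n, hn⟩ hab
  exact ⟨n + 1, Or.inr ⟨trivial, a, hn, hab⟩⟩

lemma map_mem_sball {g : G ≃g G} (hg : ∀ w, g w ∈ S ↔ w ∈ S) {x y : V} {n : ℕ} :
    g y ∈ sball G S (g x) n ↔ y ∈ sball G S x n := by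
  induction n generalizing y with
  | zero => exact g.injective.eq_iff
  | succ n ih =>
    refine or_congr ih (and_congr (hg y) ?_)
    refine g.surjective.exists.trans ?_
    exact exists_congr fun z => and_congr ih g.map_adj_iff

lemma image_sball {g : G ≃g G} (hg : ∀ w, g w ∈ S ↔ w ∈ S) (x : V) (n : ℕ) :
    g '' sball G S x n = sball G S (g x) n := by
  ext y
  obtain ⟨y, rfl⟩ := g.surjective y
  rw [map_mem_sball hg, g.injective.mem_set_image]

lemma ncard_sball (hT : TransitiveOn G S) {x y : V} (hx : x ∈ S) (hy : y ∈ S) (n : ℕ) :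
    (sball G S x n).ncard = (sball G S y n).ncard := by
  obtain ⟨g, hg, rfl⟩ := hT x hx y hy
  rw [← image_sball hg, Set.ncard_image_of_injective _ g.injective]

/-- The centre is joined to each point by steps inside the ball. A fully open ball is thus connected
by itself, as the trifurcation count and the merging of clusters require. -/
lemma reachable_of_mem_sball {H : SimpleGraph V} {x : V} {n : ℕ} {J : Set V}
    (hH : ∀ a ∈ sball G S x n, ∀ b ∈ sball G S x n, G.Adj a b → H.Adj a b)
    (hJ : Disjoint (sball G S x n) J) {a : V} (ha : a ∈ sball G S x n) :
    (avoid H J).Reachable x a := by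
  have hnot : ∀ b ∈ sball G S x n, b ∉ J := fun b hb => Set.disjoint_left.1 hJ hb
  suffices h : ∀ m ≤ n, ∀ a ∈ sball G S x m, (avoid H J).Reachable x a from h n le_rfl a ha
  intro m
  induction m with
  | zero => rintro - a rfl; exact SimpleGraph.Reachable.refl _
  | succ m ih =>
    rintro hm a (h | ⟨haS, z, hz, hza⟩)
    · exact ih (by omega) a h
    · have hz' := sball_mono x (show m ≤ n by omega) hz
      have ha' : a ∈ sball G S x n := sball_mono x hm (Or.inr ⟨haS, z, hz, hza⟩)
      exact (ih (by omega) z hz).trans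
        (SimpleGraph.Adj.reachable ⟨hH z hz' a ha' hza, hnot z hz', hnot a ha'⟩)

lemma exists_boundary_mem_sball {K : Set V} {x y : V} {n : ℕ} (hxK : x ∈ K)
    (hy : y ∈ sball G S x n) (hyK : y ∉ K) :
    ∃ z ∈ K, z ∈ sball G S x n ∧ ∃ w ∈ S, w ∉ K ∧ G.Adj z w := by
  induction n generalizing y with
  | zero => exact absurd hxK ((show y = x from hy) ▸ hyK)
  | succ n ih =>
    have key : ∀ {y}, y ∈ sball G S x n → y ∉ K →
        ∃ z ∈ K, z ∈ sball G S x (n + 1) ∧ ∃ w ∈ S, w ∉ K ∧ G.Adj z w := fun h1 h2 => by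
      obtain ⟨z, hz, hzx, h⟩ := ih h1 h2
      exact ⟨z, hz, Or.inl hzx, h⟩
    rcases hy with hy | ⟨hyS, z, hz, hzy⟩
    · exact key hy hyK
    · by_cases hzK : z ∈ K
      · exact ⟨z, hzK, Or.inl hz, y, hyS, hyK, hzy⟩
      · exact key hz hzK

open Classical in
/-- In an amenable transitive graph there are finite sets most points of which have their
`R`-ball inside the set. -/
lemma exists_finset_sball_subset (hlf : ∀ v, (G.neighborSet v).Finite) (hT : TransitiveOn G S)
    {o : V} (ho : o ∈ S) (ham : IsAmenable (G.induce S)) (R : ℕ) {ε : ℝ} (hε : 0 < ε) :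
    ∃ K : Finset V, K.Nonempty ∧ (K : Set V) ⊆ S ∧
      ((K.filter fun x => ¬ sball G S x R ⊆ K).card : ℝ) ≤ ε * K.card := by
  set N := (sball G S o R).ncard with hN
  have hNpos : 0 < N :=
    (Set.ncard_pos (finite_sball hlf o R)).2 ⟨o, self_mem_sball o R⟩
  -- A point whose `R`-ball leaves `K` lies within `R` of the inner boundary, and each boundary
  -- point accounts for at most `N` such points. Hence the tolerance ε / N.
  obtain ⟨K, hK, hKb⟩ := ham (ε / N) (by positivity)
  refine ⟨K.map (Function.Embedding.subtype _), hK.map, ?_, ?_⟩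
  · intro x hx
    obtain ⟨y, -, rfl⟩ := Finset.mem_map.1 (Finset.mem_coe.1 hx)
    exact y.2
  have hfin : (innerBoundary (G.induce S) (K : Set S)).Finite :=
    K.finite_toSet.subset fun y hy => hy.1
  have hsub : (K.map (Function.Embedding.subtype _)).filter
      (fun x => ¬ sball G S x R ⊆ (K.map (Function.Embedding.subtype _) : Finset V)) ⊆
      hfin.toFinset.biUnion fun z => (finite_sball (S := S) hlf z R).toFinset := by
    intro x hx
    obtain ⟨hxK, hxb⟩ := Finset.mem_filter.1 hx
    obtain ⟨y, hy, hyK⟩ := Set.not_subset.1 hxb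
    have hxS : x ∈ S := by
      obtain ⟨y, -, rfl⟩ := Finset.mem_map.1 hxK
      exact y.2
    obtain ⟨z, hzK, hzx, w, hwS, hwK, hzw⟩ := exists_boundary_mem_sball
      (Finset.mem_coe.2 hxK) hy hyK
    obtain ⟨z, hz, rfl⟩ := Finset.mem_map.1 (Finset.mem_coe.1 hzK)
    refine Finset.mem_biUnion.2 ⟨z, ?_, ?_⟩
    · rw [Set.Finite.mem_toFinset]
      refine ⟨hz, ⟨w, hwS⟩, fun hw => hwK ?_, hzw.symm⟩
      exact Finset.mem_coe.2 (Finset.mem_map.2 ⟨_, hw, rfl⟩)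
    · rw [Set.Finite.mem_toFinset]
      exact mem_sball_symm hxS hzx
  have h1 := (Finset.card_le_card hsub).trans Finset.card_biUnion_le
  have h2 : ∑ z ∈ hfin.toFinset, (finite_sball (S := S) hlf (z : V) R).toFinset.card =
      hfin.toFinset.card * N := by
    rw [Finset.sum_const_nat]
    intro z _
    rw [hN, ncard_sball hT ho z.2, Set.ncard_eq_toFinset_card _ (finite_sball hlf _ R)]
  rw [h2] at h1
  rw [Set.ncard_eq_toFinset_card _ hfin] at hKb
  rw [Finset.card_map]
  calc _ ≤ ((hfin.toFinset.card * N : ℕ) : ℝ) := by exact_mod_cast h1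
    _ = (hfin.toFinset.card : ℝ) * N := by push_cast; ring
    _ ≤ (ε / N * K.card) * N := by gcongr
    _ = ε * K.card := by field_simp

end Balls

end Percolation

/-! ### Product measures: resampling, unions and insertion tolerance -/

namespace Percolation

section ProductMeasures

variable {ι : Type*}

/-- The coordinate pairs are independent, as one checks on rectangles. Resampling and the union
coupling are both instances. -/
lemma map_prod_infinitePi {X Y Z : ι → Type*} [∀ i, MeasurableSpace (X i)]
    [∀ i, MeasurableSpace (Y i)] [∀ i, MeasurableSpace (Z i)]
    (μ : ∀ i, Measure (X i)) (ν : ∀ i, Measure (Y i)) [∀ i, IsProbabilityMeasure (μ i)]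
    [∀ i, IsProbabilityMeasure (ν i)] {f : ∀ i, X i × Y i → Z i} (hf : ∀ i, Measurable (f i)) :
    ((Measure.infinitePi μ).prod (Measure.infinitePi ν)).map (fun q i => f i (q.1 i, q.2 i)) =
      Measure.infinitePi fun i => ((μ i).prod (ν i)).map (f i) := by
  set P := (Measure.infinitePi μ).prod (Measure.infinitePi ν)
  have hmap : ∀ i, P.map (fun q => (q.1 i, q.2 i)) = (μ i).prod (ν i) := by
    intro i
    rw [← Measure.infinitePi_map_eval μ i, ← Measure.infinitePi_map_eval ν i,
      Measure.map_prod_map _ _ (by fun_prop) (by fun_prop)]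
    rfl
  have hind : iIndepFun (fun i (q : (∀ i, X i) × (∀ i, Y i)) => (q.1 i, q.2 i)) P := by
    refine iIndepSets.iIndep (m := fun i => MeasurableSpace.comap
        (fun q : (∀ i, X i) × (∀ i, Y i) => (q.1 i, q.2 i)) inferInstance)
      (fun i => Measurable.comap_le (by fun_prop))
      (fun i => Set.preimage (fun q : (∀ i, X i) × (∀ i, Y i) => (q.1 i, q.2 i)) ''
        (Set.image2 (· ×ˢ ·) {s : Set (X i) | MeasurableSet s} {t : Set (Y i) | MeasurableSet t}))
      (fun i => ?_) (fun i => ?_) ?_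
    · exact (isPiSystem_prod).comap _
    · rw [← generateFrom_prod, MeasurableSpace.comap_generateFrom]
    · rw [iIndepSets_iff]
      intro s F hF
      have hch : ∀ i, ∃ A : Set (X i), ∃ B : Set (Y i), MeasurableSet A ∧ MeasurableSet B ∧
          (i ∈ s → (fun q : (∀ i, X i) × (∀ i, Y i) => (q.1 i, q.2 i)) ⁻¹' (A ×ˢ B) = F i) := by
        intro i
        by_cases hi : i ∈ s
        · obtain ⟨-, ⟨A, hA, B, hB, rfl⟩, h⟩ := hF i hi
          exact ⟨A, B, hA, hB, fun _ => h⟩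
        · exact ⟨∅, ∅, .empty, .empty, fun h => absurd h hi⟩
      choose A B hA hB hFAB using hch
      have h1 : ⋂ i ∈ s, F i = Set.pi s A ×ˢ Set.pi s B := by
        ext q
        simp only [Set.mem_iInter, Set.mem_prod, Set.mem_pi]
        constructor
        · intro h
          refine ⟨fun i hi => ?_, fun i hi => ?_⟩
          · have := h i hi
            rw [← hFAB i hi] at this
            exact this.1
          · have := h i hi
            rw [← hFAB i hi] at this
            exact this.2
        · rintro ⟨h1, h2⟩ i hi
          rw [← hFAB i hi]
          exact ⟨h1 i hi, h2 i hi⟩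
      rw [h1, Measure.prod_prod, Measure.infinitePi_pi _ (fun i _ => hA i),
        Measure.infinitePi_pi _ (fun i _ => hB i), ← Finset.prod_mul_distrib]
      refine Finset.prod_congr rfl fun i hi => ?_
      rw [← hFAB i hi, ← Measure.map_apply (by fun_prop) ((hA i).prod (hB i)), hmap,
        Measure.prod_prod]
  have hpair := hind.map_fun_eq_infinitePi_map (by fun_prop)
  simp_rw [hmap] at hpair
  rw [← Measure.infinitePi_map_pi _ hf, ← hpair, Measure.map_map (by fun_prop) (by fun_prop)]
  rfl

open Classical in
/-- The configuration equal to `η` on `T` and to `ω` elsewhere. -/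
noncomputable def mix (T : Set ι) (ω η : ι → Bool) : ι → Bool := fun e => if e ∈ T then η e else ω e

lemma measurable_mix (T : Set ι) :
    Measurable (fun q : (ι → Bool) × (ι → Bool) => mix T q.1 q.2) := by
  classical
  refine measurable_pi_lambda _ fun e => ?_
  by_cases he : e ∈ T
  · simp only [mix, if_pos he]; fun_prop
  · simp only [mix, if_neg he]; fun_prop

/-- This lets the coordinates in `T` be treated as fresh once the others are fixed. Insertion
tolerance, the zero-one law and sprinkling all use it. -/
lemma measurePreserving_mix (μ : ι → Measure Bool) [∀ i, IsProbabilityMeasure (μ i)] (T : Set ι) :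
    MeasurePreserving (fun q : (ι → Bool) × (ι → Bool) => mix T q.1 q.2)
      ((Measure.infinitePi μ).prod (Measure.infinitePi μ)) (Measure.infinitePi μ) := by
  classical
  refine ⟨measurable_mix T, ?_⟩
  have := map_prod_infinitePi μ μ (f := fun i (q : Bool × Bool) => if i ∈ T then q.2 else q.1)
    (fun i => measurable_of_finite _)
  refine this.trans ?_
  congr 1
  ext1 i
  by_cases hi : i ∈ T
  · simp only [if_pos hi]
    exact Measure.map_snd_prod.trans (by rw [measure_univ, one_smul])
  · simp only [if_neg hi]
    exact Measure.map_fst_prod.trans (by rw [measure_univ, one_smul])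

lemma bernoulliMeasure_prod_map_or (a b c : I)
    (h : (1 - (c : ℝ)) = (1 - a) * (1 - b)) :
    ((bernoulliMeasure true false a).prod (bernoulliMeasure true false b)).map
      (fun q => q.1 || q.2) = bernoulliMeasure true false c := by
  have hm : Measurable (fun q : Bool × Bool => q.1 || q.2) := measurable_of_finite _
  have : IsProbabilityMeasure (((bernoulliMeasure true false a).prod
    (bernoulliMeasure true false b)).map (fun q : Bool × Bool => q.1 || q.2)) :=
      Measure.isProbabilityMeasure_map hm.aemeasurable
  have hf : (((bernoulliMeasure true false a).prod
      (bernoulliMeasure true false b)).map (fun q : Bool × Bool => q.1 || q.2)).real {false} =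
      (bernoulliMeasure true false c).real {false} := by
    rw [map_measureReal_apply hm (measurableSet_singleton _)]
    have : (fun q : Bool × Bool => q.1 || q.2) ⁻¹' {false} = {false} ×ˢ {false} := by
      ext ⟨x, y⟩; simp
    rw [this, measureReal_prod_prod]
    simp [h]
  refine Measure.ext_of_singleton fun x => ?_
  have hcompl : ({true} : Set Bool) = {false}ᶜ := by ext x; simp
  rw [← measureReal_eq_measureReal_iff]
  cases x
  · exact hf
  · rw [hcompl, probReal_compl_eq_one_sub (measurableSet_singleton _),
      probReal_compl_eq_one_sub (measurableSet_singleton _), hf]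

lemma measurePreserving_or (a b c : ι → I)
    (h : ∀ e, (1 - (c e : ℝ)) = (1 - a e) * (1 - b e)) :
    MeasurePreserving (fun (q : (ι → Bool) × (ι → Bool)) e => q.1 e || q.2 e)
      ((Measure.infinitePi fun e => bernoulliMeasure true false (a e)).prod
        (Measure.infinitePi fun e => bernoulliMeasure true false (b e)))
      (Measure.infinitePi fun e => bernoulliMeasure true false (c e)) := by
  have hm : Measurable (fun q : Bool × Bool => q.1 || q.2) := measurable_of_finite _
  refine ⟨measurable_pi_lambda _ fun e => hm.comp (g := fun q : Bool × Bool => q.1 || q.2)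
    (f := fun q : (ι → Bool) × (ι → Bool) => (q.1 e, q.2 e)) (by fun_prop), ?_⟩
  rw [map_prod_infinitePi _ _ (f := fun _ q => q.1 || q.2) (fun _ => hm)]
  congr 1
  ext1 e
  exact bernoulliMeasure_prod_map_or _ _ _ (h e)

lemma infinitePi_forall_true (r : ι → I) (F : Finset ι) :
    (Measure.infinitePi fun e => bernoulliMeasure true false (r e)) {η | ∀ e ∈ F, η e = true} =
      ENNReal.ofReal (∏ e ∈ F, (r e : ℝ)) := by
  have h : {η : ι → Bool | ∀ e ∈ F, η e = true} = Set.pi F fun _ => {true} := by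
    ext; simp [Set.mem_pi]
  rw [h, Measure.infinitePi_pi _ (fun _ _ => measurableSet_singleton _),
    ENNReal.ofReal_prod_of_nonneg fun e _ => (r e).2.1]
  refine Finset.prod_congr rfl fun e _ => ?_
  rw [← ofReal_measureReal]
  simp

lemma infinitePi_forall_false (r : ι → I) (F : Finset ι) :
    (Measure.infinitePi fun e => bernoulliMeasure true false (r e)) {η | ∀ e ∈ F, η e = false} =
      ENNReal.ofReal (∏ e ∈ F, (1 - r e : ℝ)) := by
  have h : {η : ι → Bool | ∀ e ∈ F, η e = false} = Set.pi F fun _ => {false} := by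
    ext; simp [Set.mem_pi]
  rw [h, Measure.infinitePi_pi _ (fun _ _ => measurableSet_singleton _),
    ENNReal.ofReal_prod_of_nonneg fun e _ => sub_nonneg.2 (r e).2.2]
  refine Finset.prod_congr rfl fun e _ => ?_
  rw [← ofReal_measureReal]
  simp

/-- Among infinitely many edges that are open with probability at least `s > 0`, one is open. -/
lemma ae_exists_true (r : ι → I) {s : ℝ} (hs : 0 < s) (hr : ∀ e, s ≤ r e) {T : Set ι}
    (hT : T.Infinite) :
    ∀ᵐ η ∂(Measure.infinitePi fun e => bernoulliMeasure true false (r e)), ∃ e ∈ T, η e = true := by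
  set μ := Measure.infinitePi fun e => bernoulliMeasure true false (r e)
  obtain ⟨e₀, -⟩ := hT.nonempty
  have hs1 : s ≤ 1 := (hr e₀).trans (r e₀).2.2
  rw [ae_iff]
  refine le_antisymm (ge_of_tendsto' (x := Filter.atTop)
    (f := fun n : ℕ => ENNReal.ofReal ((1 - s) ^ n)) ?_ fun n => ?_) bot_le
  · rw [show (0 : ENNReal) = ENNReal.ofReal 0 by simp]
    exact ENNReal.tendsto_ofReal
      (tendsto_pow_atTop_nhds_zero_of_lt_one (by linarith) (by linarith))
  · obtain ⟨F, hFT, hFn⟩ := hT.exists_subset_card_eq n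
    calc μ {η | ¬ ∃ e ∈ T, η e = true} ≤ μ {η | ∀ e ∈ F, η e = false} := by
          refine measure_mono fun η hη e he => ?_
          by_contra h
          exact hη ⟨e, hFT he, by simpa using h⟩
      _ = ENNReal.ofReal (∏ e ∈ F, (1 - r e : ℝ)) := infinitePi_forall_false r F
      _ ≤ ENNReal.ofReal ((1 - s) ^ n) := by
          refine ENNReal.ofReal_le_ofReal ?_
          rw [← hFn]
          rw [← Finset.prod_const]
          exact Finset.prod_le_prod (fun e _ => sub_nonneg.2 (r e).2.2)
            fun e _ => sub_le_sub_left (hr e) 1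

open Classical in
/-- Open all the edges of `F`. -/
noncomputable def insertEdges (F : Finset ι) (ω : ι → Bool) : ι → Bool :=
  fun e => if e ∈ F then true else ω e

/-- Insertion tolerance. -/
lemma ae_insertEdges (r : ι → I) (F : Finset ι) (hF : ∀ e ∈ F, 0 < r e) {P : (ι → Bool) → Prop}
    (hP : ∀ᵐ ω ∂(Measure.infinitePi fun e => bernoulliMeasure true false (r e)), P ω) :
    ∀ᵐ ω ∂(Measure.infinitePi fun e => bernoulliMeasure true false (r e)),
      P (insertEdges F ω) := by
  set μ := Measure.infinitePi fun e => bernoulliMeasure true false (r e)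
  have h1 := (measurePreserving_mix (fun e => bernoulliMeasure true false (r e))
    (F : Set ι)).quasiMeasurePreserving.ae hP
  filter_upwards [Measure.ae_ae_of_ae_prod h1] with ω hω
  by_contra hcon
  -- If the property failed after opening `F`, every resampling that is open on all of `F` would be
  -- bad, yet these have positive probability.
  have h2 : μ {η | ∀ e ∈ F, η e = true} = 0 := by
    have h0 : μ {η | ¬ P (mix F ω η)} = 0 := hω
    refine measure_mono_null (fun η hη => ?_) h0
    refine fun h => hcon ?_
    convert h using 1
    ext e
    by_cases he : e ∈ F
    · simp [insertEdges, mix, he, hη e he]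
    · simp [insertEdges, mix, he]
  rw [infinitePi_forall_true, ENNReal.ofReal_eq_zero] at h2
  exact absurd (Finset.prod_pos fun e he => show (0 : ℝ) < r e from hF e he) (not_lt.2 h2)

end ProductMeasures

end Percolation

/-! ### Zero-one law and measurability of graph events -/

namespace Percolation

universe u

variable {V : Type u}

section Ergodicity

variable {ι : Type*}

/-- A set that is invariant under permutations of the coordinates moving every finite set of
coordinates off itself has probability `0` or `1`. -/
lemma measure_eq_zero_or_one_of_invariant (ν : ι → Measure Bool) [∀ i, IsProbabilityMeasure (ν i)]
    {A : Set (ι → Bool)} (hA : MeasurableSet A)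
    (h : ∀ F : Finset ι, ∃ e : ι ≃ ι, (∀ i, ν (e i) = ν i) ∧ (∀ i ∈ F, e i ∉ F) ∧
      ∀ ω : ι → Bool, (fun i => ω (e i)) ∈ A ↔ ω ∈ A) :
    Measure.infinitePi ν A = 0 ∨ Measure.infinitePi ν A = 1 := by
  classical
  set μ := Measure.infinitePi ν
  set x := μ.real A with hx
  have hx0 : 0 ≤ x := measureReal_nonneg
  have hx1 : x ≤ 1 := measureReal_le_one
  -- For a cylinder t within ε of the event, t and its translate are independent and both
  -- approximate it, so x ≤ μ(t)² + 2ε. As μ(t) and x are at most 1 and differ by less than ε, μ(t)²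
  -- ≤ x² + 2ε.
  have key : ∀ ε : ℝ, 0 < ε → x - x ^ 2 ≤ 4 * ε := by
    intro ε hε
    obtain ⟨t, ht, htA⟩ := exists_measure_symmDiff_lt_of_generateFrom_isSetRing (μ := μ)
      (isSetRing_measurableCylinders (α := fun _ : ι => Bool))
      ⟨{Set.univ}, Set.countable_singleton _,
        Set.singleton_subset_iff.2 (univ_mem_measurableCylinders _), by simp⟩
      generateFrom_measurableCylinders.symm hA (ENNReal.ofReal_pos.2 hε)
    have htm : MeasurableSet t := .of_mem_measurableCylinders ht
    obtain ⟨F, B, hB, rfl⟩ := (mem_measurableCylinders t).1 ht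
    obtain ⟨e, heν, heF, heA⟩ := h F
    set t := cylinder (α := fun _ : ι => Bool) F B
    let T : (ι → Bool) → (ι → Bool) := fun ω i => ω (e i)
    have hT : MeasurePreserving T μ μ := by
      refine ⟨by fun_prop, ?_⟩
      refine (Measure.map_infinitePi_infinitePi_of_inj (P := ν) e.injective).trans ?_
      simp only [heν]; rfl
    have h1 : μ.real (symmDiff t A) < ε := by
      rw [measureReal_def]
      exact (ENNReal.toReal_lt_of_lt_ofReal htA)
    have h2 : μ.real (symmDiff (T ⁻¹' t) A) < ε := by
      have : symmDiff (T ⁻¹' t) A = T ⁻¹' (symmDiff t A) := by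
        rw [Set.preimage_symmDiff]
        congr 1
        ext ω; exact (heA ω).symm
      rw [this, hT.measureReal_preimage (htm.symmDiff hA).nullMeasurableSet]
      exact h1
    -- Resample the coordinates in `F`: t sees only the new values, while its translate, supported
    -- off `F`, sees only the old ones.
    have hind : μ.real (T ⁻¹' t ∩ t) = μ.real t * μ.real t := by
      have hmix := measurePreserving_mix ν (F : Set ι)
      rw [← hmix.measureReal_preimage ((hT.measurable htm).inter htm).nullMeasurableSet]
      have : (fun q : (ι → Bool) × (ι → Bool) => mix (F : Set ι) q.1 q.2) ⁻¹' (T ⁻¹' t ∩ t) =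
          (T ⁻¹' t) ×ˢ t := by
        ext ⟨ω, η⟩
        refine and_congr ?_ ?_
        · refine iff_of_eq (congrArg (· ∈ B) ?_)
          ext i
          simp [T, mix, heF i.1 i.2, Finset.restrict]
        · refine iff_of_eq (congrArg (· ∈ B) ?_)
          ext i
          simp [mix, Finset.restrict]
      rw [this, measureReal_prod_prod, hT.measureReal_preimage htm.nullMeasurableSet]
    have h3 : |μ.real t - x| < ε :=
      (abs_measureReal_sub_le_measureReal_symmDiff htm.nullMeasurableSet
        hA.nullMeasurableSet).trans_lt h1
    have h4 : x ≤ μ.real (T ⁻¹' t ∩ t) + (ε + ε) := by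
      calc x ≤ μ.real ((T ⁻¹' t ∩ t) ∪ (symmDiff (T ⁻¹' t) A ∪ symmDiff t A)) := by
            refine measureReal_mono fun ω hω => ?_
            by_cases h1 : ω ∈ T ⁻¹' t
            · by_cases h2 : ω ∈ t
              · exact Or.inl ⟨h1, h2⟩
              · exact Or.inr (Or.inr (Or.inr ⟨hω, h2⟩))
            · exact Or.inr (Or.inl (Or.inr ⟨hω, h1⟩))
        _ ≤ _ := (measureReal_union_le _ _).trans (add_le_add le_rfl
            ((measureReal_union_le _ _).trans (add_le_add h2.le h1.le)))
    have ht1 : μ.real t ≤ 1 := measureReal_le_one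
    have ht0 : 0 ≤ μ.real t := measureReal_nonneg
    rw [hind] at h4
    have := abs_lt.1 h3
    nlinarith
  have hle : x - x ^ 2 ≤ 0 := by
    refine le_of_forall_pos_le_add fun ε hε => ?_
    have := key (ε / 4) (by positivity)
    linarith
  have : x * (1 - x) = 0 := le_antisymm (by nlinarith) (mul_nonneg hx0 (by linarith))
  rcases mul_eq_zero.1 this with h0 | h0
  · exact Or.inl ((measureReal_eq_zero_iff).1 h0)
  · right
    rw [← ofReal_measureReal, ← hx, show x = 1 by linarith, ENNReal.ofReal_one]

end Ergodicity

section MeasurableGraphs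

variable {Ω : Type*} [MeasurableSpace Ω]

/-- A random graph whose adjacency events are measurable. -/
def MeasurableGraph (H : Ω → SimpleGraph V) : Prop := ∀ a b, Measurable fun ω => (H ω).Adj a b

/-- A random set whose membership events are measurable. -/
def MeasurableRandomSet (A : Ω → Set V) : Prop := ∀ a, Measurable fun ω => a ∈ A ω

/-- Reachability becomes a countable union of events of bounded depth, which gives measurability. -/
lemma mem_component_iff {H : SimpleGraph V} {a b : V} :
    b ∈ component H a ↔ ∃ n, b ∈ sball H Set.univ a n := by
  constructor
  · intro h
    refine reachable_induction (P := fun b => ∃ n, b ∈ sball H Set.univ a n)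
      ⟨0, self_mem_sball a 0⟩ ?_ h
    rintro x y - ⟨n, hn⟩ hxy
    exact ⟨n + 1, Or.inr ⟨trivial, x, hn, hxy⟩⟩
  · rintro ⟨n, hn⟩
    induction n generalizing b with
    | zero => rw [show b = a from hn]; exact SimpleGraph.Reachable.refl _
    | succ n ih =>
      rcases hn with h | ⟨-, z, hz, hzb⟩
      · exact ih h
      · exact SimpleGraph.Reachable.trans (ih hz) hzb.reachable

lemma MeasurableGraph.component [Countable V] {H : Ω → SimpleGraph V} (hH : MeasurableGraph H) (a : V) :
    MeasurableRandomSet fun ω => component (H ω) a := by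
  intro b
  simp only [mem_component_iff]
  refine Measurable.exists fun n => ?_
  induction n generalizing b with
  | zero => exact measurable_const
  | succ n ih =>
    exact (ih b).or (measurable_const.and (Measurable.exists fun z => (ih z).and (hH z b)))

lemma MeasurableGraph.reachable [Countable V] {H : Ω → SimpleGraph V} (hH : MeasurableGraph H) (a b : V) :
    Measurable fun ω => (H ω).Reachable a b := hH.component a b

lemma MeasurableGraph.avoid {H : Ω → SimpleGraph V} (hH : MeasurableGraph H) {J : Ω → Set V}
    (hJ : MeasurableRandomSet J) : MeasurableGraph fun ω => avoid (H ω) (J ω) :=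
  fun a b => (hH a b).and ((hJ a).not.and (hJ b).not)

lemma measurableRandomSet_const (S : Set V) : MeasurableRandomSet fun _ : Ω => S :=
  fun _ => measurable_const

lemma MeasurableRandomSet.inter {A B : Ω → Set V} (hA : MeasurableRandomSet A)
    (hB : MeasurableRandomSet B) : MeasurableRandomSet fun ω => A ω ∩ B ω :=
  fun a => (hA a).and (hB a)

lemma MeasurableRandomSet.infinite [Countable V] {A : Ω → Set V} (hA : MeasurableRandomSet A) :
    Measurable fun ω => (A ω).Infinite := by
  have : ∀ ω, (A ω).Infinite ↔ ∀ F : Finset V, ∃ a, a ∈ A ω ∧ a ∉ F := by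
    intro ω
    refine ⟨fun h F => ?_, fun h hfin => ?_⟩
    · obtain ⟨a, ha, haF⟩ := h.exists_notMem_finset F
      exact ⟨a, ha, haF⟩
    · obtain ⟨a, ha, haF⟩ := h hfin.toFinset
      exact haF (hfin.mem_toFinset.2 ha)
  simp only [this]
  exact Measurable.forall fun F => Measurable.exists fun a => (hA a).and measurable_const

end MeasurableGraphs

section Configurations

variable (G : SimpleGraph V)

lemma measurableGraph_openGraph : MeasurableGraph (openGraph G) := by
  intro a b
  by_cases h : G.Adj a b
  · have : ∀ ω, (openGraph G ω).Adj a b ↔ ω ⟨s(a, b), h⟩ = true :=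
      fun ω => ⟨fun h' => h'.2, fun h' => ⟨h, h'⟩⟩
    simp only [this]
    exact measurableSet_setOfPred.1 (measurableSet_eq_fun (by fun_prop) measurable_const)
  · have : ∀ ω, (openGraph G ω).Adj a b ↔ False :=
      fun ω => ⟨fun h' => h h'.1, False.elim⟩
    simp only [this]
    exact measurable_const

variable {G}

/-- The action of an automorphism on configurations. -/
def act (g : G ≃g G) (ω : Config G) : Config G := fun e => ω (g.mapEdgeSet e)

lemma openGraph_act (g : G ≃g G) (ω : Config G) :
    openGraph G (act g ω) = (openGraph G ω).comap g := by
  ext a b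
  constructor
  · rintro ⟨h, hω⟩
    exact ⟨g.map_adj_iff.2 h, hω⟩
  · rintro ⟨h, hω⟩
    exact ⟨g.map_adj_iff.1 h, hω⟩

lemma measurePreserving_act (g : G ≃g G) (r : G.edgeSet → I)
    (hr : ∀ e, r (g.mapEdgeSet e) = r e) :
    MeasurePreserving (act g) (bondMeasure G r) (bondMeasure G r) := by
  refine ⟨measurable_pi_lambda _ fun e => by unfold act; fun_prop, ?_⟩
  refine (Measure.map_infinitePi_infinitePi_of_inj
    (P := fun e => bernoulliMeasure true false (r e)) g.mapEdgeSet.injective).trans ?_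
  simp only [hr]; rfl

open Classical in
/-- The edge probabilities of `inhomMeasure`. -/
noncomputable def rate (G : SimpleGraph V) (S : Set V) (p q : I) : G.edgeSet → I :=
  fun e => if ∀ x ∈ (e : Sym2 V), x ∈ S then q else p

instance (r : G.edgeSet → I) : IsProbabilityMeasure (bondMeasure G r) := by
  unfold bondMeasure; infer_instance

instance (S : Set V) (p q : I) : IsProbabilityMeasure (inhomMeasure G S p q) := by
  unfold inhomMeasure; infer_instance

lemma rate_map {S : Set V} {g : G ≃g G} (hg : ∀ w, g w ∈ S ↔ w ∈ S) (p q : I) (e : G.edgeSet) :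
    rate G S p q (g.mapEdgeSet e) = rate G S p q e := by
  unfold rate
  have h : (∀ x ∈ ((g.mapEdgeSet e : G.edgeSet) : Sym2 V), x ∈ S) ↔ ∀ x ∈ (e : Sym2 V), x ∈ S := by
    have : ((g.mapEdgeSet e : G.edgeSet) : Sym2 V) = Sym2.map g e := rfl
    rw [this]
    constructor
    · intro h x hx
      exact (hg x).1 (h _ (Sym2.mem_map.2 ⟨x, hx, rfl⟩))
    · intro h x hx
      obtain ⟨y, hy, rfl⟩ := Sym2.mem_map.1 hx
      exact (hg y).2 (h y hy)
  by_cases h' : ∀ x ∈ (e : Sym2 V), x ∈ S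
  · rw [if_pos h', if_pos (h.2 h')]
  · rw [if_neg h', if_neg fun h'' => h' (h.1 h'')]

/-- If the edges of `F` lie within distance `N` of `o`, it suffices to move `o` to a point of `S`
farther than 2N: an edge of `F` mapped into `F` would put `g o` within 2N of `o`. -/
lemma exists_automorphism_disjoint (hG : G.Connected) (hlf : ∀ v, (G.neighborSet v).Finite)
    {S : Set V} (hS : S.Infinite) (hT : TransitiveOn G S) (F : Finset G.edgeSet) :
    ∃ g : G ≃g G, (∀ w, g w ∈ S ↔ w ∈ S) ∧ ∀ e ∈ F, g.mapEdgeSet e ∉ F := by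
  classical
  obtain ⟨o, ho⟩ := hS.nonempty
  have hball : ∀ v, ∃ n, v ∈ sball G Set.univ o n := fun v => by
    rw [← mem_component_iff]; exact hG.preconnected o v
  choose n hn using hball
  obtain ⟨N, hN⟩ : ∃ N, ∀ e ∈ F, ∀ v ∈ (e : Sym2 V), n v ≤ N := by
    refine ⟨F.sup fun e => (e : Sym2 V).toFinset.sup n, ?_⟩
    intro e he v hv
    refine le_trans ?_ (Finset.le_sup he)
    exact Finset.le_sup (f := n) (Sym2.mem_toFinset.2 hv)
  obtain ⟨x, hxS, hx⟩ := hS.exists_notMem_finite (finite_sball (S := Set.univ) hlf o (N + N))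
  obtain ⟨g, hg, rfl⟩ := hT o ho x hxS
  refine ⟨g, hg, fun e he hge => hx ?_⟩
  obtain ⟨⟨a, b⟩, hab⟩ := e
  have h1 : a ∈ sball G Set.univ o N :=
    sball_mono o (hN _ he a (Sym2.mem_mk_left a b)) (hn a)
  have h2 : g a ∈ sball G Set.univ o N :=
    sball_mono o (hN _ hge (g a) (Sym2.mem_mk_left (g a) (g b))) (hn (g a))
  have h3 : g a ∈ sball G Set.univ (g o) N :=
    (map_mem_sball (S := Set.univ) (fun w => by simp)).2 h1
  exact sball_trans h2 (mem_sball_symm trivial h3)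

/-- Events invariant under the automorphisms preserving `S` have probability `0` or `1`. -/
lemma inhomMeasure_eq_zero_or_one (hG : G.Connected) (hlf : ∀ v, (G.neighborSet v).Finite)
    {S : Set V} (hS : S.Infinite) (hT : TransitiveOn G S) (p q : I) {A : Set (Config G)}
    (hA : MeasurableSet A)
    (hinv : ∀ g : G ≃g G, (∀ w, g w ∈ S ↔ w ∈ S) → ∀ ω, act g ω ∈ A ↔ ω ∈ A) :
    inhomMeasure G S p q A = 0 ∨ inhomMeasure G S p q A = 1 := by
  refine measure_eq_zero_or_one_of_invariant
    (fun e => bernoulliMeasure true false (rate G S p q e)) hA fun F => ?_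
  obtain ⟨g, hg, hF⟩ := exists_automorphism_disjoint hG hlf hS hT F
  exact ⟨g.mapEdgeSet, fun e => by rw [rate_map hg], hF, hinv g hg⟩

end Configurations

end Percolation

/-! ### Finiteness of the clusters outside `S` -/

namespace Percolation

universe u

variable {V : Type u}

/-- The edges of `H` that do not have both endpoints in `S`. -/
def offGraph (H : SimpleGraph V) (S : Set V) : SimpleGraph V where
  Adj a b := H.Adj a b ∧ ¬ (a ∈ S ∧ b ∈ S)
  symm := ⟨fun _ _ h => ⟨h.1.symm, fun h' => h.2 ⟨h'.2, h'.1⟩⟩⟩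
  loopless := ⟨fun x h => H.loopless.irrefl x h.1⟩

lemma offGraph_le (H : SimpleGraph V) (S : Set V) : offGraph H S ≤ H := fun _ _ h => h.1

lemma openGraph_le (G : SimpleGraph V) (ω : Config G) : openGraph G ω ≤ G := fun _ _ h => h.1

lemma mem_sball_of_walk {H : SimpleGraph V} {x z : V} (w : H.Walk x z) :
    z ∈ sball H Set.univ x w.length := by
  induction w with
  | nil => exact self_mem_sball _ 0
  | @cons a b c hab w ih =>
    rw [SimpleGraph.Walk.length_cons, add_comm]
    exact sball_trans (Or.inr ⟨trivial, a, rfl, hab⟩) ih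

/-- An infinite component leaves the ball of radius `n`, so some path is long enough to be cut at
length `n`. Its edges are distinct, so their openness probabilities multiply. -/
lemma exists_trail_length_eq {H : SimpleGraph V} (hlf : ∀ v, (H.neighborSet v).Finite) {x : V}
    (hx : (component H x).Infinite) (n : ℕ) :
    ∃ z, ∃ w : H.Walk x z, w.IsTrail ∧ w.length = n := by
  classical
  obtain ⟨z, hz, hzn⟩ := hx.exists_notMem_finite (finite_sball (S := Set.univ) hlf x n)
  obtain ⟨w, hw⟩ := SimpleGraph.Reachable.exists_isPath hz
  have hn : n ≤ w.length := by
    by_contra h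
    exact hzn (sball_mono x (by omega) (mem_sball_of_walk w))
  exact ⟨_, w.take n, (hw.take n).isTrail, by
    rw [SimpleGraph.Walk.take_length]; exact min_eq_left hn⟩

open Classical in
/-- The lists of edges of the walks of length `n` from `x`. -/
noncomputable def walkEdges (G : SimpleGraph V) [G.LocallyFinite] :
    ℕ → V → Finset (List (Sym2 V))
  | 0, _ => {[]}
  | n + 1, x => (G.neighborFinset x).biUnion fun y =>
      (walkEdges G n y).image fun l => s(x, y) :: l

lemma card_walkEdges_le {G : SimpleGraph V} [G.LocallyFinite] {d : ℕ} (hd : ∀ v, G.degree v ≤ d)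
    (n : ℕ) (x : V) : (walkEdges G n x).card ≤ d ^ n := by
  classical
  induction n generalizing x with
  | zero => simp [walkEdges]
  | succ n ih =>
    refine Finset.card_biUnion_le.trans ?_
    calc _ ≤ ∑ y ∈ G.neighborFinset x, d ^ n :=
          Finset.sum_le_sum fun y _ => Finset.card_image_le.trans (ih y)
      _ = G.degree x * d ^ n := by
          rw [Finset.sum_const, smul_eq_mul, SimpleGraph.card_neighborFinset_eq_degree]
      _ ≤ d * d ^ n := Nat.mul_le_mul_right _ (hd x)
      _ = d ^ (n + 1) := by ring

lemma edges_mem_walkEdges {G H : SimpleGraph V} [G.LocallyFinite] (h : H ≤ G) {x z : V}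
    (w : H.Walk x z) : w.edges ∈ walkEdges G w.length x := by
  classical
  induction w with
  | nil => simp [walkEdges]
  | @cons a b c hab w ih =>
    refine Finset.mem_biUnion.2 ⟨b, (G.mem_neighborFinset _ _).2 (h hab), ?_⟩
    exact Finset.mem_image.2 ⟨_, ih, rfl⟩

/-- If `d p < 1`, the clusters of the open edges outside `S` are finite. -/
lemma ae_finite_offGraph_component {G : SimpleGraph V} [G.LocallyFinite] [Countable V] {d : ℕ}
    (hd : ∀ v, G.degree v ≤ d) (S : Set V) (p q : I) (hdp : (d : ℝ) * p < 1) :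
    ∀ᵐ ω ∂(inhomMeasure G S p q), ∀ x,
      (component (offGraph (openGraph G ω) S) x).Finite := by
  classical
  rw [ae_all_iff]
  intro x
  rw [ae_iff]
  have hlf : ∀ v, (G.neighborSet v).Finite := fun v => Set.toFinite _
  refine le_antisymm (ge_of_tendsto' (x := Filter.atTop)
    (f := fun n : ℕ => ENNReal.ofReal ((d * p : ℝ) ^ n)) ?_ fun n => ?_) bot_le
  · rw [show (0 : ENNReal) = ENNReal.ofReal 0 by simp]
    exact ENNReal.tendsto_ofReal
      (tendsto_pow_atTop_nhds_zero_of_lt_one (mul_nonneg (Nat.cast_nonneg _) p.2.1) hdp)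
  -- Union bound over edge lists of trails outside E_S: there are at most dⁿ lists, each open with
  -- probability pⁿ.
  · set 𝒲 := (walkEdges G n x).filter fun l =>
      l.Nodup ∧ l.length = n ∧ ∀ e ∈ l, e ∈ G.edgeSet ∧ ¬ ∀ v ∈ e, v ∈ S with h𝒲
    let E : List (Sym2 V) → Finset G.edgeSet := fun l => l.toFinset.subtype (· ∈ G.edgeSet)
    calc inhomMeasure G S p q {ω | ¬ (component (offGraph (openGraph G ω) S) x).Finite}
        ≤ inhomMeasure G S p q (⋃ l ∈ 𝒲, {ω | ∀ e ∈ E l, ω e = true}) := by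
          refine measure_mono fun ω hω => ?_
          obtain ⟨z, w, hw, hwn⟩ := exists_trail_length_eq (H := offGraph (openGraph G ω) S)
            (fun v => (hlf v).subset fun y hy => hy.1.1) hω n
          have hadj : ∀ e ∈ w.edges, (∃ h : e ∈ G.edgeSet, ω ⟨e, h⟩ = true) ∧
              ¬ ∀ v ∈ e, v ∈ S := by
            intro e he
            have := w.edges_subset_edgeSet he
            induction e with
            | _ a b =>
              obtain ⟨⟨h1, h2⟩, h3⟩ := this
              exact ⟨⟨h1, h2⟩, fun h => h3 ⟨h a (Sym2.mem_mk_left a b),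
                h b (Sym2.mem_mk_right a b)⟩⟩
          refine Set.mem_biUnion (x := w.edges) (Finset.mem_coe.2 (Finset.mem_filter.2
            ⟨hwn ▸ edges_mem_walkEdges ((offGraph_le _ _).trans (openGraph_le _ _)) w,
              hw.edges_nodup, by rw [SimpleGraph.Walk.length_edges, hwn],
              fun e he => ⟨(hadj e he).1.1, (hadj e he).2⟩⟩)) ?_
          intro e he
          have : (e : Sym2 V) ∈ w.edges := by simpa [E] using he
          exact (hadj e this).1.2
      _ ≤ ∑ l ∈ 𝒲, inhomMeasure G S p q {ω | ∀ e ∈ E l, ω e = true} :=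
          measure_biUnion_finset_le _ _
      _ ≤ ∑ l ∈ 𝒲, ENNReal.ofReal ((p : ℝ) ^ n) := by
          refine Finset.sum_le_sum fun l hl => ?_
          obtain ⟨-, hnd, hln, hlG⟩ := Finset.mem_filter.1 hl
          refine (infinitePi_forall_true (rate G S p q) (E l)).le.trans ?_
          refine ENNReal.ofReal_le_ofReal (le_of_eq ?_)
          have hcard : (E l).card = n := by
            rw [Finset.card_subtype, Finset.filter_true_of_mem fun e he =>
              (hlG e (List.mem_toFinset.1 he)).1, List.toFinset_card_of_nodup hnd, hln]
          rw [← hcard]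
          refine Finset.prod_eq_pow_card fun e he => ?_
          have : (e : Sym2 V) ∈ l := by simpa [E] using he
          rw [rate, if_neg (hlG _ this).2]
      _ ≤ ENNReal.ofReal ((d * p : ℝ) ^ n) := by
          rw [Finset.sum_const, nsmul_eq_mul, mul_pow, ENNReal.ofReal_mul (by positivity)]
          gcongr
          rw [← ENNReal.ofReal_natCast]
          refine ENNReal.ofReal_le_ofReal ?_
          exact_mod_cast (Finset.card_filter_le _ _).trans (card_walkEdges_le hd n x)

end Percolation

/-! ### Equivariance, expected counts and separated sets -/

namespace Percolation

universe u

variable {V : Type u}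

section Equivariance

variable {G : SimpleGraph V}

lemma reachable_comap_iff (g : G ≃g G) (H : SimpleGraph V) {a b : V} :
    (H.comap g).Reachable a b ↔ H.Reachable (g a) (g b) :=
  (SimpleGraph.Iso.reachable_iff (φ := SimpleGraph.Iso.comap g.toEquiv H)).symm

lemma component_comap (g : G ≃g G) (H : SimpleGraph V) (a : V) :
    component (H.comap g) a = g ⁻¹' component H (g a) :=
  Set.ext fun _ => reachable_comap_iff g H

lemma infinite_preimage_iff (g : G ≃g G) {A : Set V} : (g ⁻¹' A).Infinite ↔ A.Infinite := by
  rw [← Set.infinite_image_iff g.injective.injOn, Set.image_preimage_eq _ g.surjective]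

lemma preimage_sball {S : Set V} {g : G ≃g G} (hg : ∀ w, g w ∈ S ↔ w ∈ S) (x : V) (n : ℕ) :
    g ⁻¹' sball G S (g x) n = sball G S x n := Set.ext fun _ => map_mem_sball hg

lemma avoid_comap (g : G ≃g G) (H : SimpleGraph V) (J : Set V) :
    avoid (H.comap g) (g ⁻¹' J) = (avoid H J).comap g := rfl

lemma offGraph_comap {S : Set V} {g : G ≃g G} (hg : ∀ w, g w ∈ S ↔ w ∈ S) (H : SimpleGraph V) :
    offGraph (H.comap g) S = (offGraph H S).comap g := by
  ext a b
  simp [offGraph, hg]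

lemma measureReal_eq_of_equivariant {Ω : Type*} [MeasurableSpace Ω] {μ : Measure Ω} {S : Set V}
    (hT : TransitiveOn G S) (T : (G ≃g G) → Ω → Ω)
    (hTm : ∀ g : G ≃g G, (∀ w, g w ∈ S ↔ w ∈ S) → MeasurePreserving (T g) μ μ)
    {E : V → Ω → Prop} (hE : ∀ x, Measurable (E x))
    (hEq : ∀ g : G ≃g G, (∀ w, g w ∈ S ↔ w ∈ S) → ∀ x ω, E x (T g ω) ↔ E (g x) ω)
    {x y : V} (hx : x ∈ S) (hy : y ∈ S) : μ.real {ω | E x ω} = μ.real {ω | E y ω} := by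
  obtain ⟨g, hg, rfl⟩ := hT x hx y hy
  rw [← (hTm g hg).measureReal_preimage (measurableSet_setOfPred.2 (hE x)).nullMeasurableSet]
  congr 1
  ext ω
  exact hEq g hg x ω

end Equivariance

open Classical in
lemma sum_measureReal_le_of_card_le {Ω ι : Type*} [MeasurableSpace Ω] {μ : Measure Ω}
    [IsProbabilityMeasure μ] {E F : ι → Ω → Prop} (hE : ∀ x, Measurable (E x))
    (hF : ∀ x, Measurable (F x)) (A B : Finset ι) (c b : ℝ)
    (h : ∀ᵐ ω ∂μ, ((A.filter fun x => E x ω).card : ℝ) ≤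
      c * (B.filter fun x => F x ω).card + b) :
    ∑ x ∈ A, μ.real {ω | E x ω} ≤ c * ∑ x ∈ B, μ.real {ω | F x ω} + b := by
  have hcard : ∀ (E : ι → Ω → Prop) (A : Finset ι) ω,
      ((A.filter fun x => E x ω).card : ℝ) =
        ∑ x ∈ A, Set.indicator {ω | E x ω} (fun _ => (1 : ℝ)) ω := by
    intro E A ω
    rw [Finset.card_filter]
    push_cast
    refine Finset.sum_congr rfl fun x _ => ?_
    by_cases hx : E x ω
    · simp [hx]
    · simp [hx]
  have hint : ∀ (E : ι → Ω → Prop), (∀ x, Measurable (E x)) → ∀ x,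
      Integrable (Set.indicator {ω | E x ω} (fun _ => (1 : ℝ))) μ := fun E hE x =>
    (integrable_const 1).indicator (measurableSet_setOfPred.2 (hE x))
  have hval : ∀ (E : ι → Ω → Prop), (∀ x, Measurable (E x)) → ∀ A : Finset ι,
      ∫ ω, ∑ x ∈ A, Set.indicator {ω | E x ω} (fun _ => (1 : ℝ)) ω ∂μ =
        ∑ x ∈ A, μ.real {ω | E x ω} := by
    intro E hE A
    rw [integral_finsetSum _ fun x _ => hint E hE x]
    refine Finset.sum_congr rfl fun x _ => ?_
    rw [integral_indicator_const _ (measurableSet_setOfPred.2 (hE x))]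
    simp
  simp only [hcard] at h
  have h1 := integral_mono_ae (integrable_finsetSum A fun x _ => hint E hE x)
    (((integrable_finsetSum B fun x _ => hint F hF x).const_mul c).add (integrable_const b)) h
  rw [hval E hE] at h1
  refine h1.trans (le_of_eq ?_)
  rw [integral_add' ((integrable_finsetSum B fun x _ => hint F hF x).const_mul c)
    (integrable_const b), integral_const_mul, hval F hF]
  simp

/-- For a maximal separated subset, the balls of radius `r + r` around its points cover `A`. -/
lemma exists_separated_subset {G : SimpleGraph V} (hlf : ∀ v, (G.neighborSet v).Finite)
    {S : Set V} (r D : ℕ) (A : Finset V) (hA : (A : Set V) ⊆ S)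
    (hD : ∀ x ∈ S, (sball G S x (r + r)).ncard ≤ D) :
    ∃ A' ⊆ A, (∀ x ∈ A', ∀ y ∈ A', x ≠ y → Disjoint (sball G S x r) (sball G S y r)) ∧
      A.card ≤ D * A'.card := by
  classical
  let sep : Finset V → Prop := fun A' =>
    ∀ x ∈ A', ∀ y ∈ A', x ≠ y → Disjoint (sball G S x r) (sball G S y r)
  obtain ⟨A', hA', hmax⟩ := Finset.exists_max_image (A.powerset.filter sep) Finset.card
    ⟨∅, Finset.mem_filter.2 ⟨Finset.empty_mem_powerset A, by simp [sep]⟩⟩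
  obtain ⟨hsub, hsep⟩ := Finset.mem_filter.1 hA'
  rw [Finset.mem_powerset] at hsub
  refine ⟨A', hsub, hsep, ?_⟩
  have hcov : A ⊆ A'.biUnion fun b => (finite_sball (S := S) hlf b (r + r)).toFinset := by
    intro a ha
    rw [Finset.mem_biUnion]
    simp only [Set.Finite.mem_toFinset]
    by_contra hcon
    push Not at hcon
    have haA' : a ∉ A' := fun h => hcon a h (self_mem_sball a _)
    have hdis : ∀ b ∈ A', Disjoint (sball G S b r) (sball G S a r) := by
      intro b hb
      rw [Set.disjoint_left]
      intro z hz hz'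
      exact hcon b hb (sball_trans hz (mem_sball_symm (hA ha) hz'))
    have hins : sep (insert a A') := by
      intro x hx y hy hxy
      rcases Finset.mem_insert.1 hx with hx | hx <;> rcases Finset.mem_insert.1 hy with hy | hy
      · exact absurd (hx.trans hy.symm) hxy
      · rw [hx]; exact (hdis y hy).symm
      · rw [hy]; exact hdis x hx
      · exact hsep x hx y hy hxy
    have := hmax (insert a A') (Finset.mem_filter.2
      ⟨Finset.mem_powerset.2 (Finset.insert_subset ha hsub), hins⟩)
    rw [Finset.card_insert_of_notMem haA'] at this
    omega
  refine (Finset.card_le_card hcov).trans (Finset.card_biUnion_le.trans ?_)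
  rw [mul_comm, ← smul_eq_mul, ← Finset.sum_const]
  refine Finset.sum_le_sum fun b hb => ?_
  rw [← Set.ncard_eq_toFinset_card _ (finite_sball hlf b (r + r))]
  exact hD b (hA (hsub hb))

/-- A component with finitely many points in `S` is covered by the off-`S` clusters of those points
and of `v`. The subgraph `K` allows application after a ball has been removed. -/
lemma infinite_component_inter {H K : SimpleGraph V} (hKH : K ≤ H) {S : Set V}
    (hfin : ∀ x, (component (offGraph H S) x).Finite) {v : V} (hv : (component K v).Infinite) :
    (component K v ∩ S).Infinite := by
  intro hcon
  have hle : offGraph K S ≤ offGraph H S := fun a b h => ⟨hKH h.1, h.2⟩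
  refine hv (((hfin v).union (hcon.biUnion fun x _ => hfin x)).subset fun w hw => ?_)
  refine reachable_induction (P := fun w => w ∈ component (offGraph H S) v ∪
    ⋃ x ∈ component K v ∩ S, component (offGraph H S) x) (Or.inl (SimpleGraph.Reachable.refl _))
    ?_ hw
  intro a b hva ha hab
  by_cases hb : b ∈ S
  · exact Or.inr (Set.mem_biUnion (x := b) ⟨hva.trans hab.reachable, hb⟩
      (SimpleGraph.Reachable.refl _))
  have hadj : (offGraph H S).Adj a b := ⟨hKH hab, fun h => hb h.2⟩
  rcases ha with ha | ha
  · exact Or.inl (SimpleGraph.Reachable.trans ha hadj.reachable)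
  · obtain ⟨x, hx, hxa⟩ := Set.mem_iUnion₂.1 ha
    exact Or.inr (Set.mem_biUnion hx (SimpleGraph.Reachable.trans hxa hadj.reachable))

end Percolation

/-! ### Trifurcations and opening all edges of a finite set -/

namespace Percolation

universe u

variable {V : Type u}

/-- `H` has exactly one infinite component. -/
def HasUniqueInfinite (H : SimpleGraph V) : Prop :=
  (∃ v, (component H v).Infinite) ∧
    ∀ u v, (component H u).Infinite → (component H v).Infinite → H.Reachable u v

/-- `W` is fully open and its removal leaves three infinite components attached to it. -/
def IsTrifurcation (G H : SimpleGraph V) (W : Set V) : Prop :=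
  (∀ a ∈ W, ∀ b ∈ W, G.Adj a b → H.Adj a b) ∧ ∃ f : Fin 3 → V,
    (∀ k, f k ∉ W ∧ (∃ w ∈ W, H.Adj w (f k)) ∧ (component (avoid H W) (f k)).Infinite) ∧
    ∀ k l, k ≠ l → ¬ (avoid H W).Reachable (f k) (f l)

/-- The graph `H` together with all the edges of `G` inside `W`. -/
def fill (G H : SimpleGraph V) (W : Set V) : SimpleGraph V where
  Adj a b := H.Adj a b ∨ G.Adj a b ∧ a ∈ W ∧ b ∈ W
  symm := ⟨fun _ _ h => h.imp (fun h => h.symm) fun h => ⟨h.1.symm, h.2.2, h.2.1⟩⟩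
  loopless := ⟨fun x h => h.elim (H.loopless.irrefl x) fun h => G.loopless.irrefl x h.1⟩

lemma le_fill (G H : SimpleGraph V) (W : Set V) : H ≤ fill G H W := fun _ _ h => Or.inl h

lemma avoid_fill (G H : SimpleGraph V) (W : Set V) : avoid (fill G H W) W = avoid H W := by
  ext a b
  constructor
  · rintro ⟨h | h, ha, hb⟩
    · exact ⟨h, ha, hb⟩
    · exact absurd h.2.1 ha
  · rintro ⟨h, ha, hb⟩
    exact ⟨Or.inl h, ha, hb⟩

/-- Removing the finite set `W` leaves in each of the three clusters an infinite piece next to `W`.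
Pieces of distinct clusters stay separated, since filling `W` changes nothing off `W`. -/
lemma isTrifurcation_fill {G H : SimpleGraph V} (hlf : ∀ v, (H.neighborSet v).Finite)
    {W : Set V} (hW : W.Finite) {f : Fin 3 → V} (hfW : ∀ k, f k ∈ W)
    (hf : ∀ k, (component H (f k)).Infinite) (hfn : ∀ k l, k ≠ l → ¬ H.Reachable (f k) (f l)) :
    IsTrifurcation G (fill G H W) W := by
  have h : ∀ k, ∃ u ∈ component H (f k), u ∉ W ∧ (u = f k ∨ ∃ j ∈ W, H.Adj j u) ∧
      (component (avoid H W) u ∩ Set.univ).Infinite := fun k =>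
    exists_infinite_component_avoid hlf (by rw [Set.inter_univ]; exact hf k)
      (hW.inter_of_right _)
  choose u hu huW hadj hinf using h
  refine ⟨fun a ha b hb hab => Or.inr ⟨hab, ha, hb⟩, u, fun k => ⟨huW k, ?_, ?_⟩, ?_⟩
  · rcases hadj k with h | ⟨j, hj, hju⟩
    · exact absurd (hfW k) (h ▸ huW k)
    · exact ⟨j, hj, Or.inl hju⟩
  · rw [avoid_fill]
    have := hinf k
    rwa [Set.inter_univ] at this
  · intro k l hkl h
    rw [avoid_fill] at h
    have h' : H.Reachable (u k) (u l) := h.mono (avoid_le H W)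
    exact hfn k l hkl (SimpleGraph.Reachable.trans (hu k) (h'.trans (SimpleGraph.Reachable.symm (hu l))))

/-- A component of the filled graph that misses `W` lies in a single component of `H`. If infinite,
it would be connected to `x` or `y`, hence to `W`. -/
lemma hasUniqueInfinite_fill {G H : SimpleGraph V} {W : Set V} {x y : V}
    (hW : ∀ w ∈ W, (fill G H W).Reachable x w) (hy : y ∈ W)
    (hxi : (component H x).Infinite)
    (h : ∀ z, (component H z).Infinite → H.Reachable x z ∨ H.Reachable y z) :
    HasUniqueInfinite (fill G H W) := by
  have key : ∀ z, (component (fill G H W) z).Infinite → (fill G H W).Reachable x z := by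
    intro z hz
    by_cases hzW : ∃ w ∈ W, (fill G H W).Reachable z w
    · obtain ⟨w, hw, hzw⟩ := hzW
      exact (hW w hw).trans hzw.symm
    push Not at hzW
    have hsub : component (fill G H W) z ⊆ component H z := by
      intro b hb
      refine reachable_induction (P := fun b => b ∈ component H z)
        (SimpleGraph.Reachable.refl _) ?_ hb
      intro a b hza ha hab
      rcases hab with hab | hab
      · exact SimpleGraph.Reachable.trans ha hab.reachable
      · exact absurd hza (hzW a hab.2.1)
    rcases h z (hz.mono hsub) with h | h
    · exact h.mono (le_fill G H W)
    · exact absurd (h.mono (le_fill G H W)).symm (hzW y hy)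
  exact ⟨⟨x, hxi.mono (component_mono (le_fill G H W) x)⟩,
    fun u v hu hv => (key u hu).symm.trans (key v hv)⟩

/-- `Y` collects the points of `K` from which the cluster can escape `K`. From any other point,
steps within `S` and excursions outside `S` return to `K`, so a branch that avoids `Y` has only
finitely many points in `S`. -/
lemma exists_mem_component_avoid {H : SimpleGraph V} {S W : Set V} {K Y : Finset V}
    (hWK : W ⊆ K) (hWY : ∀ w ∈ W, w ∉ Y)
    (hY : ∀ x ∈ K, x ∉ Y → component (offGraph H S) x ∩ S ⊆ K ∧
      ∀ y ∈ S, H.Adj x y → y ∈ K) {w v : V} (hw : w ∈ W)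
    (hwv : H.Adj w v) (hv : (component (avoid H W) v ∩ S).Infinite) :
    ∃ y ∈ Y, y ∈ component (avoid H W) v := by
  by_contra hcon
  push Not at hcon
  -- Invariant of the exploration: the current vertex is in `K`, or is on an off-`S` excursion from
  -- a good point of `K`.
  let Q : V → Prop := fun z => z ∈ K ∨ z ∉ S ∧ ∃ x ∈ K, x ∉ Y ∧ z ∈ component (offGraph H S) x
  have step : ∀ a b, a ∉ Y → Q a → H.Adj a b → Q b := by
    intro a b haY ha hab
    rcases ha with ha | ⟨haS, x, hx, hxY, hxa⟩
    · by_cases hb : b ∈ S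
      · exact Or.inl ((hY a ha haY).2 b hb hab)
      · exact Or.inr ⟨hb, a, ha, haY, SimpleGraph.Adj.reachable ⟨hab, fun h => hb h.2⟩⟩
    · have hxb : b ∈ component (offGraph H S) x := SimpleGraph.Reachable.trans hxa
        (SimpleGraph.Adj.reachable ⟨hab, fun h => haS h.1⟩)
      by_cases hb : b ∈ S
      · exact Or.inl ((hY x hx hxY).1 ⟨hxb, hb⟩)
      · exact Or.inr ⟨hb, x, hx, hxY, hxb⟩
  have hQ : ∀ z, (avoid H W).Reachable v z → Q z := fun z hz =>
    reachable_induction (P := Q) (step w v (hWY w hw) (Or.inl (hWK hw)) hwv)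
      (fun a b hva ha hab => step a b (fun h => hcon a h hva) ha hab.1) hz
  refine hv (K.finite_toSet.subset ?_)
  rintro z ⟨hz, hzS⟩
  exact (hQ z hz).resolve_right fun h => h.1 hzS

section Equivariance

variable {G : SimpleGraph V}

lemma hasUniqueInfinite_comap (g : G ≃g G) (H : SimpleGraph V) :
    HasUniqueInfinite (H.comap g) ↔ HasUniqueInfinite H := by
  unfold HasUniqueInfinite
  simp only [component_comap, infinite_preimage_iff, reachable_comap_iff]
  refine and_congr
    (g.surjective.exists (p := fun v => (component H v).Infinite)).symm ?_
  refine Iff.trans (forall_congr' fun u => ?_) g.surjective.forall.symm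
  exact (g.surjective.forall (p := fun v => (component H (g u)).Infinite →
    (component H v).Infinite → H.Reachable (g u) v)).symm

lemma isTrifurcation_comap (g : G ≃g G) (H : SimpleGraph V) (W : Set V) :
    IsTrifurcation G (H.comap g) (g ⁻¹' W) ↔ IsTrifurcation G H W := by
  have hs : Function.Surjective fun (f : Fin 3 → V) k => g (f k) := fun f =>
    ⟨fun k => g.symm (f k), by ext k; simp⟩
  unfold IsTrifurcation
  refine and_congr ?_ ?_
  · refine Iff.trans ?_ g.surjective.forall.symm
    refine forall_congr' fun a => imp_congr Iff.rfl ?_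
    refine Iff.trans ?_ g.surjective.forall.symm
    exact forall_congr' fun b => imp_congr Iff.rfl (imp_congr g.map_adj_iff.symm Iff.rfl)
  · refine Iff.trans ?_ hs.exists.symm
    refine exists_congr fun f => and_congr (forall_congr' fun k => and_congr Iff.rfl
      (and_congr ?_ ?_)) (forall_congr' fun k => forall_congr' fun l => imp_congr Iff.rfl
        (not_congr ?_))
    · exact (g.surjective.exists (p := fun w => w ∈ W ∧ H.Adj w (g (f k)))).symm
    · rw [avoid_comap, component_comap, infinite_preimage_iff]
    · rw [avoid_comap, reachable_comap_iff]

end Equivariance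

lemma MeasurableGraph.offGraph {Ω : Type*} [MeasurableSpace Ω] {H : Ω → SimpleGraph V}
    (hH : MeasurableGraph H) (S : Set V) :
    MeasurableGraph fun ω => Percolation.offGraph (H ω) S :=
  fun a b => (hH a b).and measurable_const

section Measurability

variable {Ω : Type*} [MeasurableSpace Ω] [Countable V] {H : Ω → SimpleGraph V}

lemma MeasurableGraph.infinite (hH : MeasurableGraph H) (v : V) :
    Measurable fun ω => (Percolation.component (H ω) v).Infinite :=
  (hH.component v).infinite

lemma MeasurableGraph.hasUniqueInfinite (hH : MeasurableGraph H) :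
    Measurable fun ω => HasUniqueInfinite (H ω) :=
  (Measurable.exists fun v => hH.infinite v).and <| Measurable.forall fun u =>
    Measurable.forall fun v => (hH.infinite u).imp ((hH.infinite v).imp (hH.reachable u v))

lemma MeasurableGraph.isTrifurcation (hH : MeasurableGraph H) (G : SimpleGraph V) (W : Set V) :
    Measurable fun ω => IsTrifurcation G (H ω) W := by
  have hA : MeasurableGraph fun ω => Percolation.avoid (H ω) W :=
    hH.avoid (measurableRandomSet_const W)
  refine Measurable.and ?_ (Measurable.exists fun f => Measurable.and ?_ ?_)
  · exact Measurable.forall fun a => measurable_const.imp (Measurable.forall fun b =>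
      measurable_const.imp (measurable_const.imp (hH a b)))
  · exact Measurable.forall fun k => measurable_const.and ((Measurable.exists fun w =>
      measurable_const.and (hH w (f k))).and (hA.infinite (f k)))
  · exact Measurable.forall fun k => Measurable.forall fun l =>
      measurable_const.imp (hA.reachable _ _).not

end Measurability

/-- Insertion tolerance inside a finite subset of `S`. -/
lemma ae_fill {G : SimpleGraph V} {S W : Set V} (hW : W.Finite) (hWS : W ⊆ S) {p q : I}
    (hq : 0 < q) {P : SimpleGraph V → Prop}
    (h : ∀ᵐ ω ∂(inhomMeasure G S p q), P (openGraph G ω)) :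
    ∀ᵐ ω ∂(inhomMeasure G S p q), P (fill G (openGraph G ω) W) := by
  classical
  have hmem : ∀ e : G.edgeSet, e ∈ hW.toFinset.sym2.subtype (· ∈ G.edgeSet) ↔
      ∀ v ∈ (e : Sym2 V), v ∈ W := by
    intro e
    simp [Finset.mem_subtype, Finset.mem_sym2_iff]
  have := ae_insertEdges (rate G S p q) (hW.toFinset.sym2.subtype (· ∈ G.edgeSet))
    (fun e he => by
      rw [rate, if_pos fun v hv => hWS ((hmem e).1 he v hv)]; exact hq)
    (P := fun ω => P (openGraph G ω)) h
  filter_upwards [this] with ω hω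
  convert hω using 1
  ext a b
  constructor
  · rintro (⟨hab, hω⟩ | ⟨hab, ha, hb⟩)
    · refine ⟨hab, ?_⟩
      simp only [insertEdges, hω, ite_self]
    · refine ⟨hab, ?_⟩
      rw [insertEdges, if_pos]
      rw [hmem]
      intro v hv
      rcases Sym2.mem_iff.1 hv with rfl | rfl <;> assumption
  · rintro ⟨hab, hω⟩
    unfold insertEdges at hω
    split_ifs at hω with hF
    · rw [hmem] at hF
      exact Or.inr ⟨hab, hF a (Sym2.mem_mk_left a b), hF b (Sym2.mem_mk_right a b)⟩
    · exact Or.inl ⟨hab, hω⟩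

end Percolation

/-! ### Burton–Keane argument for finite off-`S` clusters -/

namespace Percolation

universe u

variable {V : Type u} {G : SimpleGraph V} {S : Set V}

-- Let `Y` be the set of bad points. Trifurcation balls missing `Y` have a point of `Y` in each
-- branch, and the deterministic count bounds them by |Y|. Those meeting `Y` inject into it by
-- disjointness. This gives the factor 2.
open Classical in
lemma card_trifurcations_le {H : SimpleGraph V} (hHG : H ≤ G)
    (hfin : ∀ x, (component (offGraph H S) x).Finite) {K K' : Finset V} {r R : ℕ}
    (hrR : r ≤ R) (hR : 1 ≤ R)
    (hK' : ∀ x ∈ K', x ∈ K ∧ sball G S x R ⊆ K)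
    (hsep : ∀ x ∈ K', ∀ y ∈ K', x ≠ y → Disjoint (sball G S x r) (sball G S y r)) :
    (K'.filter fun x => IsTrifurcation G H (sball G S x r)).card ≤
      2 * ((K.filter fun x => ¬ sball G S x R ⊆ K).card +
        (K.filter fun x => ¬ component (offGraph H S) x ∩ S ⊆ sball G S x R).card) := by
  set Y := (K.filter fun x => ¬ sball G S x R ⊆ K) ∪
    K.filter fun x => ¬ component (offGraph H S) x ∩ S ⊆ sball G S x R with hYdef
  set T := K'.filter fun x => IsTrifurcation G H (sball G S x r) with hT
  have hTK' : ∀ x ∈ T, x ∈ K' := fun x hx => (Finset.mem_filter.1 hx).1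
  have hY : ∀ x ∈ K, x ∉ Y → component (offGraph H S) x ∩ S ⊆ K ∧
      ∀ y ∈ S, H.Adj x y → y ∈ K := by
    intro x hx hxY
    have h1 : sball G S x R ⊆ K := by
      by_contra h
      exact hxY (Finset.mem_union_left _ (Finset.mem_filter.2 ⟨hx, h⟩))
    have h2 : component (offGraph H S) x ∩ S ⊆ sball G S x R := by
      by_contra h
      exact hxY (Finset.mem_union_right _ (Finset.mem_filter.2 ⟨hx, h⟩))
    exact ⟨h2.trans h1, fun y hy hxy =>
      h1 (sball_mono x hR (Or.inr ⟨hy, x, rfl, hHG hxy⟩))⟩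
  have hT1 : (T.filter fun x => ∀ w ∈ sball G S x r, w ∉ Y).card ≤ Y.card := by
    refine card_le_card_of_trifurcations (H := H) (fun x => sball G S x r) _ _ rfl Y ?_ ?_ ?_ ?_
    · intro x hx y hy hxy
      exact hsep x (hTK' x (Finset.mem_filter.1 hx).1) y (hTK' y (Finset.mem_filter.1 hy).1) hxy
    · exact fun x _ => ⟨x, self_mem_sball x r⟩
    · intro x hx J hJ a ha b hb
      have hopen := (Finset.mem_filter.1 (Finset.mem_filter.1 hx).1).2.1
      exact (reachable_of_mem_sball hopen hJ ha).symm.trans (reachable_of_mem_sball hopen hJ hb)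
    · intro x hx
      obtain ⟨hxT, hxY⟩ := Finset.mem_filter.1 hx
      obtain ⟨-, f, hf, hfn⟩ := (Finset.mem_filter.1 hxT).2
      have hWK : sball G S x r ⊆ K := (sball_mono x hrR).trans (hK' x (hTK' x hxT)).2
      have hex : ∀ k, ∃ y ∈ Y, y ∈ component (avoid H (sball G S x r)) (f k) := by
        intro k
        obtain ⟨-, ⟨w, hw, hwf⟩, hinf⟩ := hf k
        exact exists_mem_component_avoid hWK hxY hY hw hwf
          (infinite_component_inter (avoid_le H _) hfin hinf)
      choose y hyY hy using hex
      refine ⟨y, fun k => ⟨hyY k, notMem_of_reachable_avoid (hy k) (hf k).1, ?_⟩, ?_⟩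
      · obtain ⟨-, ⟨w, hw, hwf⟩, -⟩ := hf k
        exact ⟨w, hw, (SimpleGraph.Reachable.mono (avoid_le H _) (hy k)).symm.trans
          hwf.symm.reachable⟩
      · intro k l hkl h
        exact hfn k l hkl (SimpleGraph.Reachable.trans (hy k)
          (h.trans (SimpleGraph.Reachable.symm (hy l))))
  have hT2 : (T.filter fun x => ¬ ∀ w ∈ sball G S x r, w ∉ Y).card ≤ Y.card := by
    have hex : ∀ x ∈ T.filter fun x => ¬ ∀ w ∈ sball G S x r, w ∉ Y,
        ∃ w ∈ sball G S x r, w ∈ Y := by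
      intro x hx
      have := (Finset.mem_filter.1 hx).2
      push Not at this
      exact this
    choose! w hw hwY using hex
    refine Finset.card_le_card_of_injOn w hwY ?_
    intro x hx y hy hxy
    by_contra hne
    have hd := hsep x (hTK' x (Finset.mem_filter.1 hx).1) y
      (hTK' y (Finset.mem_filter.1 hy).1) hne
    exact Set.disjoint_left.1 hd (hw x hx) (hxy ▸ hw y hy)
  have hsplit := Finset.card_filter_add_card_filter_not (s := T)
    (fun x => ∀ w ∈ sball G S x r, w ∉ Y)
  have hYcard := Finset.card_union_le (K.filter fun x => ¬ sball G S x R ⊆ K)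
    (K.filter fun x => ¬ component (offGraph H S) x ∩ S ⊆ sball G S x R)
  rw [← hYdef] at hYcard
  omega

variable [Countable V]

lemma measurable_not_component_subset {Ω : Type*} [MeasurableSpace Ω] {H : Ω → SimpleGraph V}
    (hH : MeasurableGraph H) (S B : Set V) (x : V) :
    Measurable fun ω => ¬ component (H ω) x ∩ S ⊆ B := by
  refine Measurable.not ?_
  have : ∀ ω, component (H ω) x ∩ S ⊆ B ↔ ∀ y, y ∈ component (H ω) x ∩ S → y ∈ B :=
    fun ω => Iff.rfl
  simp only [this]
  exact Measurable.forall fun y =>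
    (((hH.component x).inter (measurableRandomSet_const S)) y).imp measurable_const

/-- The clusters of the open edges outside `S` are tight. -/
lemma exists_measureReal_offGraph_lt (hS : (G.induce S).Connected) {o : V}
    (ho : o ∈ S) {p q : I}
    (hoff : ∀ᵐ ω ∂(inhomMeasure G S p q), ∀ x, (component (offGraph (openGraph G ω) S) x).Finite)
    {δ : ℝ} (hδ : 0 < δ) (R₀ : ℕ) : ∃ R, R₀ ≤ R ∧ (inhomMeasure G S p q).real
      {ω | ¬ component (offGraph (openGraph G ω) S) o ∩ S ⊆ sball G S o R} < δ := by
  set μ := inhomMeasure G S p q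
  let E : ℕ → Set (Config G) := fun R =>
    {ω | ¬ component (offGraph (openGraph G ω) S) o ∩ S ⊆ sball G S o R}
  have hEm : ∀ R, MeasurableSet (E R) := fun R => measurableSet_setOfPred.2
    (measurable_not_component_subset ((measurableGraph_openGraph G).offGraph S) S _ o)
  have hanti : Antitone E := fun R R' h ω hω hsub => hω (hsub.trans (sball_mono o h))
  have hzero : μ (⋂ R, E R) = 0 := by
    refine measure_mono_null ?_ (ae_iff.1 hoff)
    intro ω hω hfin
    have hex : ∀ y ∈ ((hfin o).subset (Set.inter_subset_left (t := S))).toFinset,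
        ∃ n, y ∈ sball G S o n := fun y hy =>
      exists_mem_sball hS ho ((Set.Finite.mem_toFinset _).1 hy).2
    choose! n hn using hex
    refine Set.mem_iInter.1 hω
      (((hfin o).subset (Set.inter_subset_left (t := S))).toFinset.sup n) fun y hy => ?_
    have hy' := (Set.Finite.mem_toFinset ((hfin o).subset (Set.inter_subset_left (t := S)))).2 hy
    exact sball_mono o (Finset.le_sup hy') (hn y hy')
  have hlim := tendsto_measure_iInter_atTop (μ := μ) (fun R => (hEm R).nullMeasurableSet) hanti
    ⟨0, measure_ne_top _ _⟩
  rw [hzero] at hlim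
  have hev := (hlim.eventually_lt_const (ENNReal.ofReal_pos.2 hδ)).and
    (Filter.eventually_ge_atTop R₀)
  obtain ⟨R, hR1, hR2⟩ := hev.exists
  exact ⟨R, hR2, ENNReal.toReal_lt_of_lt_ofReal hR1⟩

/-- Trifurcations have probability zero in the amenable case with small clusters outside `S`. -/
lemma measureReal_isTrifurcation_eq_zero (hlf : ∀ v, (G.neighborSet v).Finite)
    (hS : (G.induce S).Connected) (hT : TransitiveOn G S) (ham : IsAmenable (G.induce S)) {o : V}
    (ho : o ∈ S) {p q : I}
    (hoff : ∀ᵐ ω ∂(inhomMeasure G S p q), ∀ x, (component (offGraph (openGraph G ω) S) x).Finite)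
    (r : ℕ) :
    (inhomMeasure G S p q).real {ω | IsTrifurcation G (openGraph G ω) (sball G S o r)} = 0 := by
  classical
  set μ := inhomMeasure G S p q
  set β := μ.real {ω | IsTrifurcation G (openGraph G ω) (sball G S o r)} with hβ
  by_contra hne
  have hβ0 : 0 < β := lt_of_le_of_ne measureReal_nonneg (Ne.symm hne)
  have hβ1 : β ≤ 1 := measureReal_le_one
  set D := (sball G S o (r + r)).ncard with hDdef
  have hD : 1 ≤ D := (Set.ncard_pos (finite_sball hlf o _)).2 ⟨o, self_mem_sball o _⟩
  have hD' : (1 : ℝ) ≤ D := by exact_mod_cast hD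
  -- With this ε, the points near the boundary and the expected number with far-reaching off-`S`
  -- clusters are each at most ε|K|, so |K'|β ≤ 4ε|K|. Since D|K'| ≥ |A| ≥ (7/8)|K|, this yields
  -- (7/8)β|K| ≤ β|K|/2, which is absurd.
  have hε : 0 < β / (8 * D) := by positivity
  obtain ⟨R, hR, hRlt⟩ := exists_measureReal_offGraph_lt hS ho hoff hε (max r 1)
  obtain ⟨K, hK, hKS, hKb⟩ := exists_finset_sball_subset hlf hT ho ham R hε
  set A := K.filter fun x => sball G S x R ⊆ K
  obtain ⟨K', hK'A, hsep, hcard⟩ := exists_separated_subset (S := S) hlf r D A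
    (fun x hx => hKS (Finset.mem_filter.1 hx).1)
    (fun x hx => (ncard_sball hT hx ho _).le)
  have hact : ∀ g : G ≃g G, (∀ w, g w ∈ S ↔ w ∈ S) → MeasurePreserving (act g) μ μ :=
    fun g hg => measurePreserving_act g _ (rate_map hg p q)
  have hmO := measurableGraph_openGraph G
  have hE : ∀ x, Measurable fun ω => IsTrifurcation G (openGraph G ω) (sball G S x r) :=
    fun x => hmO.isTrifurcation G _
  have hF : ∀ x, Measurable fun ω =>
      ¬ component (offGraph (openGraph G ω) S) x ∩ S ⊆ sball G S x R :=
    fun x => measurable_not_component_subset (hmO.offGraph S) S _ x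
  have hsum := sum_measureReal_le_of_card_le (μ := μ) hE hF K' K 2
    (2 * ((K.filter fun x => ¬ sball G S x R ⊆ K).card : ℝ)) (by
      filter_upwards [hoff] with ω hω
      have := card_trifurcations_le (openGraph_le G ω) hω (K := K) (K' := K') (r := r) (R := R)
        ((le_max_left _ _).trans hR) ((le_max_right _ _).trans hR)
        (fun x hx => Finset.mem_filter.1 (hK'A hx)) hsep
      have h' : ((K'.filter fun x => IsTrifurcation G (openGraph G ω) (sball G S x r)).card : ℝ) ≤
        2 * ((K.filter fun x => ¬ sball G S x R ⊆ K).card +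
        (K.filter fun x => ¬ component (offGraph (openGraph G ω) S) x ∩ S ⊆ sball G S x R).card) := by
        exact_mod_cast this
      rw [mul_add, add_comm] at h'
      convert h')
  have hEq : ∀ x ∈ S, μ.real {ω | IsTrifurcation G (openGraph G ω) (sball G S x r)} = β :=
    fun x hx => measureReal_eq_of_equivariant hT act hact hE (fun g hg x ω => by
      rw [openGraph_act, ← preimage_sball hg, isTrifurcation_comap]) hx ho
  have hFq : ∀ x ∈ S, μ.real {ω | ¬ component (offGraph (openGraph G ω) S) x ∩ S ⊆
      sball G S x R} ≤ β / (8 * D) := fun x hx => by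
    refine (measureReal_eq_of_equivariant hT act hact hF (fun g hg x ω => ?_) hx ho).trans_le
      hRlt.le
    rw [openGraph_act, offGraph_comap hg, component_comap, ← preimage_sball hg]
    refine not_congr ?_
    have hSg : S = g ⁻¹' S := Set.ext fun w => (hg w).symm
    conv_lhs => rw [hSg]
    rw [← Set.preimage_inter, g.surjective.preimage_subset_preimage_iff, ← hSg]
  have hK'S : ∀ x ∈ K', x ∈ S := fun x hx => hKS (Finset.mem_filter.1 (hK'A hx)).1
  rw [Finset.sum_congr rfl fun x hx => hEq x (hK'S x hx), Finset.sum_const, nsmul_eq_mul] at hsum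
  have hsum2 : ∑ x ∈ K, μ.real {ω | ¬ component (offGraph (openGraph G ω) S) x ∩ S ⊆
      sball G S x R} ≤ K.card * (β / (8 * D)) := by
    rw [← nsmul_eq_mul]
    exact Finset.sum_le_card_nsmul _ _ _ fun x hx => hFq x (hKS hx)
  have hsplit : (A.card : ℝ) + (K.filter fun x => ¬ sball G S x R ⊆ K).card = K.card := by
    exact_mod_cast Finset.card_filter_add_card_filter_not (s := K) (fun x => sball G S x R ⊆ K)
  have hKpos : (0 : ℝ) < K.card := by exact_mod_cast hK.card_pos
  have hcard' : (A.card : ℝ) ≤ D * K'.card := by exact_mod_cast hcard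
  have h1 : (K'.card : ℝ) * β ≤ 4 * (K.card * (β / (8 * D))) := by
    have : β / (8 * D) * K.card = K.card * (β / (8 * D)) := mul_comm _ _
    linarith
  have h2 : (D * K'.card : ℝ) * β ≤ K.card * β / 2 := by
    calc (D * K'.card : ℝ) * β = D * (K'.card * β) := by ring
      _ ≤ D * (4 * (K.card * (β / (8 * D)))) := by gcongr
      _ = K.card * β / 2 := by field_simp; ring
  have h3 : β / (8 * D) ≤ 1 / 8 := by
    rw [div_le_div_iff₀ (by positivity) (by norm_num)]
    linarith
  have h4 : (7 / 8 : ℝ) * K.card ≤ A.card := by nlinarith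
  have h5 : (7 / 8 : ℝ) * K.card * β ≤ K.card * β / 2 :=
    (mul_le_mul_of_nonneg_right (h4.trans hcard') hβ0.le).trans h2
  have : 0 < K.card * β := by positivity
  nlinarith

/-- Uniqueness of the infinite cluster when the clusters outside `S` are finite. -/
lemma ae_hasUniqueInfinite_of_finite_off (hG : G.Connected)
    (hlf : ∀ v, (G.neighborSet v).Finite) (hS : (G.induce S).Connected) (hSinf : S.Infinite)
    (hT : TransitiveOn G S) (ham : IsAmenable (G.induce S)) {p q : I} (hq : 0 < q)
    (hoff : ∀ᵐ ω ∂(inhomMeasure G S p q), ∀ x, (component (offGraph (openGraph G ω) S) x).Finite)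
    (hperc : ∃ v, inhomMeasure G S p q (percolates G v) ≠ 0) :
    ∀ᵐ ω ∂(inhomMeasure G S p q), HasUniqueInfinite (openGraph G ω) := by
  set μ := inhomMeasure G S p q
  obtain ⟨o, ho⟩ := hSinf.nonempty
  have hmO := measurableGraph_openGraph G
  have hlfH : ∀ ω v, ((openGraph G ω).neighborSet v).Finite := fun ω v =>
    (hlf v).subset fun y hy => hy.1
  have hUm : MeasurableSet {ω | HasUniqueInfinite (openGraph G ω)} :=
    measurableSet_setOfPred.2 hmO.hasUniqueInfinite
  rcases inhomMeasure_eq_zero_or_one hG hlf hSinf hT p q hUm (fun g hg ω => by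
    simp only [Set.mem_ofPred_eq]; rw [openGraph_act, hasUniqueInfinite_comap]) with h0 | h1
  swap
  · rw [ae_iff]
    exact (prob_compl_eq_zero_iff hUm).2 h1
  -- If uniqueness has probability zero, it remains to exclude two clusters, and three or more. Any
  -- infinite cluster would then imply one of these, contradicting percolation.
  exfalso
  have hnotU : ∀ᵐ ω ∂μ, ¬ HasUniqueInfinite (openGraph G ω) := by
    rw [ae_iff]; simpa using h0
  have hball : ∀ F : Finset V, (F : Set V) ⊆ S → ∃ r, (F : Set V) ⊆ sball G S o r := by
    intro F hF
    have hex : ∀ y ∈ F, ∃ n, y ∈ sball G S o n := fun y hy => exists_mem_sball hS ho (hF hy)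
    choose! n hn using hex
    exact ⟨F.sup n, fun y hy => sball_mono o (Finset.le_sup hy) (hn y hy)⟩
  have hpull : ∀ {H : SimpleGraph V}, (∀ x, (component (offGraph H S) x).Finite) →
      ∀ v, (component H v).Infinite → ∃ x ∈ S, H.Reachable v x := by
    intro H hfin v hv
    obtain ⟨x, hx, hxS⟩ := (infinite_component_inter le_rfl hfin hv).nonempty
    exact ⟨x, hxS, hx⟩
  -- three infinite clusters would give trifurcations
  have hthree : ∀ f : Fin 3 → V, (∀ k, f k ∈ S) → ∀ᵐ ω ∂μ,
      ¬ ((∀ k, (component (openGraph G ω) (f k)).Infinite) ∧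
        ∀ k l, k ≠ l → ¬ (openGraph G ω).Reachable (f k) (f l)) := by
    classical
    intro f hfS
    obtain ⟨r, hr⟩ := hball (Finset.univ.image f) (by
      intro y hy
      obtain ⟨k, -, rfl⟩ := Finset.mem_image.1 (Finset.mem_coe.1 hy)
      exact hfS k)
    have htri : ∀ᵐ ω ∂μ, ¬ IsTrifurcation G (openGraph G ω) (sball G S o r) := by
      rw [ae_iff]
      have := measureReal_isTrifurcation_eq_zero hlf hS hT ham ho hoff r
      rw [measureReal_eq_zero_iff] at this
      simpa using this
    have := ae_fill (finite_sball hlf o r) (sball_subset ho r) hq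
      (P := fun H => ¬ IsTrifurcation G H (sball G S o r)) htri
    filter_upwards [this] with ω hω hcon
    exact hω (isTrifurcation_fill (hlfH ω) (finite_sball hlf o r) (fun k => hr
      (Finset.mem_coe.2 (Finset.mem_image_of_mem f (Finset.mem_univ k)))) hcon.1 hcon.2)
  have hthree' : ∀ᵐ ω ∂μ, ∀ f : Fin 3 → V, (∀ k, f k ∈ S) →
      ¬ ((∀ k, (component (openGraph G ω) (f k)).Infinite) ∧
        ∀ k l, k ≠ l → ¬ (openGraph G ω).Reachable (f k) (f l)) := by
    rw [ae_all_iff]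
    intro f
    by_cases hf : ∀ k, f k ∈ S
    · filter_upwards [hthree f hf] with ω hω _ using hω
    · exact Filter.Eventually.of_forall fun ω h => absurd h hf
  -- two infinite clusters can be joined
  have htwo : ∀ x y : V, x ∈ S → y ∈ S → ∀ᵐ ω ∂μ,
      ¬ ((component (openGraph G ω) x).Infinite ∧ ∀ z, (component (openGraph G ω) z).Infinite →
        (openGraph G ω).Reachable x z ∨ (openGraph G ω).Reachable y z) := by
    classical
    intro x y hx hy
    obtain ⟨r, hr⟩ := hball {x, y} (by
      intro z hz
      rcases Finset.mem_insert.1 (Finset.mem_coe.1 hz) with rfl | hz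
      · exact hx
      · rw [Finset.mem_singleton.1 hz]; exact hy)
    -- Opening a ball that contains x and y would make the infinite cluster unique, an event of
    -- probability zero.
    have := ae_fill (finite_sball hlf o r) (sball_subset ho r) hq
      (P := fun H => ¬ HasUniqueInfinite H) hnotU
    filter_upwards [this] with ω hω hcon
    have hxW : x ∈ sball G S o r := hr (by simp)
    have hyW : y ∈ sball G S o r := hr (by simp)
    have hconn : ∀ w ∈ sball G S o r,
        (fill G (openGraph G ω) (sball G S o r)).Reachable o w := fun w hw =>
      SimpleGraph.Reachable.mono (avoid_le _ ∅) (reachable_of_mem_sball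
        (fun a ha b hb hab => Or.inr ⟨hab, ha, hb⟩) (Set.disjoint_empty _) hw)
    exact hω (hasUniqueInfinite_fill (fun w hw => (hconn x hxW).symm.trans (hconn w hw)) hyW
      hcon.1 hcon.2)
  have htwo' : ∀ᵐ ω ∂μ, ∀ x y : V, x ∈ S → y ∈ S →
      ¬ ((component (openGraph G ω) x).Infinite ∧ ∀ z, (component (openGraph G ω) z).Infinite →
        (openGraph G ω).Reachable x z ∨ (openGraph G ω).Reachable y z) := by
    simp only [ae_all_iff]
    exact htwo
  obtain ⟨v, hv⟩ := hperc
  refine hv ?_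
  have : ∀ᵐ ω ∂μ, ω ∉ percolates G v := by
    filter_upwards [hoff, hthree', htwo', hnotU] with ω hfin h3 h2 hU hvω
    obtain ⟨x, hxS, hvx⟩ := hpull hfin v hvω
    have hxi : (component (openGraph G ω) x).Infinite := by
      rw [← component_eq hvx]; exact hvω
    -- a second infinite cluster
    obtain ⟨y, hyS, hyi, hxy⟩ : ∃ y ∈ S, (component (openGraph G ω) y).Infinite ∧
        ¬ (openGraph G ω).Reachable x y := by
      by_contra hcon
      push Not at hcon
      have key : ∀ z, (component (openGraph G ω) z).Infinite → (openGraph G ω).Reachable x z := by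
        intro z hz
        obtain ⟨y, hyS, hzy⟩ := hpull hfin z hz
        exact (hcon y hyS (by rw [← component_eq hzy]; exact hz)).trans hzy.symm
      exact hU ⟨⟨x, hxi⟩, fun a b ha hb => (key a ha).symm.trans (key b hb)⟩
    refine h2 x y hxS hyS ⟨hxi, fun z hz => ?_⟩
    by_contra hcon
    push Not at hcon
    obtain ⟨w, hwS, hzw⟩ := hpull hfin z hz
    have hwi : (component (openGraph G ω) w).Infinite := by
      rw [← component_eq hzw]; exact hz
    have hxw : ¬ (openGraph G ω).Reachable x w := fun h => hcon.1 (h.trans hzw.symm)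
    have hyw : ¬ (openGraph G ω).Reachable y w := fun h => hcon.2 (h.trans hzw.symm)
    refine h3 ![x, y, w] (fun k => ?_) ⟨fun k => ?_, fun k l hkl h => ?_⟩
    · fin_cases k <;> assumption
    · fin_cases k <;> assumption
    · fin_cases k <;> fin_cases l
      · exact hkl rfl
      · exact hxy h
      · exact hxw h
      · exact hxy h.symm
      · exact hkl rfl
      · exact hyw h
      · exact hxw h.symm
      · exact hyw h.symm
      · exact hkl rfl
  rw [ae_iff] at this
  simpa using this

end Percolation

/-! ### Amenable double counting and sprinkling -/

namespace Percolation

universe u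

variable {V : Type u} {G : SimpleGraph V} {S : Set V}

/-- In an amenable setting, an infinite cluster meets an equivariant random set in no point or in
infinitely many points. -/
lemma ae_infinite_inter_of_mem [Countable V] (hlf : ∀ v, (G.neighborSet v).Finite)
    (hS : (G.induce S).Connected) (hT : TransitiveOn G S) (ham : IsAmenable (G.induce S))
    {Ω : Type*} [MeasurableSpace Ω] {μ : Measure Ω} [IsProbabilityMeasure μ]
    (T : (G ≃g G) → Ω → Ω)
    (hTm : ∀ g : G ≃g G, (∀ w, g w ∈ S ↔ w ∈ S) → MeasurePreserving (T g) μ μ)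
    {H : Ω → SimpleGraph V} (hH : MeasurableGraph H)
    (hHT : ∀ g : G ≃g G, (∀ w, g w ∈ S ↔ w ∈ S) → ∀ ω, H (T g ω) = (H ω).comap g)
    {N : Ω → Set V} (hN : MeasurableRandomSet N)
    (hNT : ∀ g : G ≃g G, (∀ w, g w ∈ S ↔ w ∈ S) → ∀ ω, N (T g ω) = g ⁻¹' N ω) :
    ∀ᵐ ω ∂μ, ∀ x ∈ S, (component (H ω) x ∩ S).Infinite → x ∈ N ω →
      (component (H ω) x ∩ (N ω ∩ S)).Infinite := by
  classical
  -- The event to be excluded is truncated: the cluster has at most `k` marked points in `S`, but at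
  -- least `L` points in the `R`-ball of `x`.
  let few : ℕ → V → Ω → Prop := fun k x ω =>
    ∃ F : Finset V, F.card ≤ k ∧ ∀ a, a ∈ component (H ω) x ∩ (N ω ∩ S) → a ∈ F
  let many : ℕ → ℕ → V → Ω → Prop := fun L R x ω =>
    ∃ F : Finset V, L ≤ F.card ∧ ∀ a, a ∈ F → a ∈ component (H ω) x ∩ sball G S x R
  let E : ℕ → ℕ → ℕ → V → Ω → Prop := fun k L R x ω => x ∈ N ω ∧ few k x ω ∧ many L R x ω
  have hfew : ∀ k x, Measurable (few k x) := fun k x =>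
    Measurable.exists fun F => measurable_const.and (Measurable.forall fun a =>
      ((hH.component x).inter (hN.inter (measurableRandomSet_const S)) a).imp measurable_const)
  have hmany : ∀ L R x, Measurable (many L R x) := fun L R x =>
    Measurable.exists fun F => measurable_const.and (Measurable.forall fun a =>
      measurable_const.imp ((hH.component x).inter (measurableRandomSet_const _) a))
  have hE : ∀ k L R x, Measurable (E k L R x) := fun k L R x =>
    (hN x).and ((hfew k x).and (hmany L R x))
  have hfewT : ∀ g : G ≃g G, (∀ w, g w ∈ S ↔ w ∈ S) → ∀ k x ω,
      few k x (T g ω) ↔ few k (g x) ω := by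
    intro g hg k x ω
    have hset : component (H (T g ω)) x ∩ (N (T g ω) ∩ S) =
        g ⁻¹' (component (H ω) (g x) ∩ (N ω ∩ S)) := by
      rw [hHT g hg, hNT g hg, component_comap, Set.preimage_inter, Set.preimage_inter]
      congr 2
      exact Set.ext fun w => (hg w).symm
    constructor
    · rintro ⟨F, hF, h⟩
      refine ⟨F.map g.toEquiv.toEmbedding, by rwa [Finset.card_map], fun a ha => ?_⟩
      obtain ⟨b, rfl⟩ := g.surjective a
      exact Finset.mem_map_of_mem g.toEquiv.toEmbedding (h b (by rw [hset]; exact ha))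
    · rintro ⟨F, hF, h⟩
      refine ⟨F.map g.symm.toEquiv.toEmbedding, by rwa [Finset.card_map], fun a ha => ?_⟩
      rw [hset] at ha
      have := Finset.mem_map_of_mem g.symm.toEquiv.toEmbedding (h _ ha)
      simpa using this
  have hmanyT : ∀ g : G ≃g G, (∀ w, g w ∈ S ↔ w ∈ S) → ∀ L R x ω,
      many L R x (T g ω) ↔ many L R (g x) ω := by
    intro g hg L R x ω
    have hset : component (H (T g ω)) x ∩ sball G S x R =
        g ⁻¹' (component (H ω) (g x) ∩ sball G S (g x) R) := by
      rw [hHT g hg, component_comap, Set.preimage_inter, preimage_sball hg]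
    constructor
    · rintro ⟨F, hF, h⟩
      refine ⟨F.map g.toEquiv.toEmbedding, by rwa [Finset.card_map], fun a ha => ?_⟩
      obtain ⟨b, hb, rfl⟩ := Finset.mem_map.1 ha
      have := h b hb
      rw [hset] at this
      exact this
    · rintro ⟨F, hF, h⟩
      refine ⟨F.map g.symm.toEquiv.toEmbedding, by rwa [Finset.card_map], fun a ha => ?_⟩
      obtain ⟨b, hb, rfl⟩ := Finset.mem_map.1 ha
      have := h b hb
      rw [hset]
      simpa using this
  have hET : ∀ g : G ≃g G, (∀ w, g w ∈ S ↔ w ∈ S) → ∀ k L R x ω,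
      E k L R x (T g ω) ↔ E k L R (g x) ω := fun g hg k L R x ω =>
    and_congr (by rw [hNT g hg]; rfl) (and_congr (hfewT g hg k x ω) (hmanyT g hg L R x ω))
  -- counting inside a finite set
  have hcount : ∀ (k L R : ℕ) (K : Finset V), (K : Set V) ⊆ S → ∀ ω,
      ((K.filter fun x => sball G S x R ⊆ K).filter fun x => E k L R x ω).card * L ≤
        K.card * k := by
    intro k L R K hKS ω
    -- Count pairs (x, z) with z ∈ K in the cluster of x. Each x sees at least `L` such z, its ball
    -- being inside `K`. All x seen by one z are marked points of a single cluster, so there are at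
    -- most `k`.
    refine Finset.card_mul_le_card_mul (fun x z => z ∈ component (H ω) x) ?_ ?_
    · intro x hx
      obtain ⟨hxK, -, -, F, hFL, hF⟩ := Finset.mem_filter.1 hx
      refine hFL.trans (Finset.card_le_card fun a ha => ?_)
      exact Finset.mem_filter.2 ⟨(Finset.mem_filter.1 hxK).2 (hF a ha).2, (hF a ha).1⟩
    · intro z _
      rcases Finset.eq_empty_or_nonempty (Finset.bipartiteBelow
        (fun x z => z ∈ component (H ω) x)
        ((K.filter fun x => sball G S x R ⊆ K).filter fun x => E k L R x ω) z) with h0 | ⟨x₀, hx₀⟩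
      · rw [h0]; simp
      obtain ⟨hx₀A, hz₀⟩ := Finset.mem_filter.1 hx₀
      obtain ⟨-, -, ⟨F, hFk, hF⟩, -⟩ := Finset.mem_filter.1 hx₀A
      refine (Finset.card_le_card fun x hx => ?_).trans hFk
      obtain ⟨hxA, hz⟩ := Finset.mem_filter.1 hx
      obtain ⟨hxK, hxN, -⟩ := Finset.mem_filter.1 hxA
      exact hF x ⟨SimpleGraph.Reachable.trans hz₀ (SimpleGraph.Reachable.symm hz), hxN,
        hKS (Finset.mem_filter.1 hxK).1⟩
  have hmain : ∀ x ∈ S, ∀ k, ∀ᵐ ω ∂μ,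
      ¬ (x ∈ N ω ∧ few k x ω ∧ (component (H ω) x ∩ S).Infinite) := by
    intro x hx k
    rw [ae_iff]
    simp only [not_not]
    set B : Set Ω := {ω | x ∈ N ω ∧ few k x ω ∧ (component (H ω) x ∩ S).Infinite} with hB
    by_contra hne
    have hβ : 0 < μ.real B := by
      rw [measureReal_def]; exact ENNReal.toReal_pos hne (measure_ne_top _ _)
    -- Taking expectations, with |A| ≥ |K|/2 and probability above μ(B)/2 at each point of `A`, the
    -- count gives μ(B)/4 ≤ k/L. This choice of `L` contradicts it.
    obtain ⟨L, hL⟩ := exists_nat_gt (4 * k / μ.real B)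
    have hL0 : (0 : ℝ) < L := lt_of_le_of_lt (by positivity) hL
    have hmono : Monotone fun R => {ω | E k L R x ω} := by
      rintro R R' hRR' ω ⟨h1, h2, F, hF, h3⟩
      exact ⟨h1, h2, F, hF, fun a ha => ⟨(h3 a ha).1, sball_mono x hRR' (h3 a ha).2⟩⟩
    have hsub : B ⊆ ⋃ R, {ω | E k L R x ω} := by
      rintro ω ⟨h1, h2, h3⟩
      obtain ⟨F, hFsub, hFL⟩ := h3.exists_subset_card_eq L
      have hex : ∀ y ∈ F, ∃ n, y ∈ sball G S x n := fun y hy =>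
        exists_mem_sball hS hx (hFsub (Finset.mem_coe.2 hy)).2
      choose! n hn using hex
      exact Set.mem_iUnion.2 ⟨F.sup n, h1, h2, F, hFL.ge, fun a ha =>
        ⟨(hFsub (Finset.mem_coe.2 ha)).1, sball_mono x (Finset.le_sup ha) (hn a ha)⟩⟩
    have hlim := tendsto_measure_iUnion_atTop (μ := μ) hmono
    have hlt : ENNReal.ofReal (μ.real B / 2) < μ (⋃ R, {ω | E k L R x ω}) := by
      refine lt_of_lt_of_le ?_ (measure_mono hsub)
      rw [← ofReal_measureReal (s := B)]
      exact (ENNReal.ofReal_lt_ofReal_iff hβ).2 (half_lt_self hβ)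
    obtain ⟨R, hR⟩ := (hlim.eventually_const_lt hlt).exists
    have hR' : μ.real B / 2 < μ.real {ω | E k L R x ω} :=
      (ENNReal.ofReal_lt_iff_lt_toReal (by positivity) (measure_ne_top _ _)).1 hR
    obtain ⟨K, hK, hKS, hKb⟩ := exists_finset_sball_subset hlf hT hx ham R
      (ε := 1 / 2) (by norm_num)
    set A := K.filter fun x => sball G S x R ⊆ K with hA
    have hsum := sum_measureReal_le_of_card_le (μ := μ) (hE k L R) (hE k L R) A ∅ 0
      (K.card * k / L) (Filter.Eventually.of_forall fun ω => by
        rw [zero_mul, zero_add, le_div_iff₀ hL0]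
        have := hcount k L R K hKS ω
        have h' : (((A.filter fun x => E k L R x ω).card : ℕ) : ℝ) * L ≤ K.card * k := by
          exact_mod_cast this
        refine le_trans (le_of_eq ?_) h'
        congr!)
    have hAS : ∀ y ∈ A, y ∈ S := fun y hy => hKS (Finset.mem_filter.1 hy).1
    rw [Finset.sum_congr rfl fun y hy => measureReal_eq_of_equivariant hT T hTm (hE k L R)
      (fun g hg => hET g hg k L R) (hAS y hy) hx, Finset.sum_const, nsmul_eq_mul, zero_mul,
      zero_add] at hsum
    have hsplit : (A.card : ℝ) + (K.filter fun x => ¬ sball G S x R ⊆ K).card = K.card := by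
      exact_mod_cast Finset.card_filter_add_card_filter_not (s := K)
        (fun x => sball G S x R ⊆ K)
    have hKpos : (0 : ℝ) < K.card := by exact_mod_cast hK.card_pos
    have hAK : (K.card : ℝ) / 2 ≤ A.card := by linarith
    have h1 : (K.card : ℝ) / 2 * (μ.real B / 2) ≤ K.card * k / L :=
      (mul_le_mul hAK hR'.le (by positivity) (by positivity)).trans hsum
    rw [le_div_iff₀ hL0] at h1
    rw [div_lt_iff₀ hβ] at hL
    nlinarith
  have hall : ∀ᵐ ω ∂μ, ∀ x, x ∈ S → ∀ k,
      ¬ (x ∈ N ω ∧ few k x ω ∧ (component (H ω) x ∩ S).Infinite) := by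
    rw [ae_all_iff]
    intro x
    by_cases hx : x ∈ S
    · filter_upwards [ae_all_iff.2 (hmain x hx)] with ω hω _ using hω
    · exact Filter.Eventually.of_forall fun ω h => absurd h hx
  filter_upwards [hall] with ω hω x hx hinf hxN hfin
  refine hω x hx hfin.toFinset.card ⟨hxN, ⟨hfin.toFinset, le_rfl, fun a ha => ?_⟩, hinf⟩
  exact hfin.mem_toFinset.2 ha

/-- The `m`-neighbourhood of `A` in `G`. -/
def nbhd (G : SimpleGraph V) (A : Set V) : ℕ → Set V
  | 0 => A
  | m + 1 => {y | y ∈ nbhd G A m ∨ ∃ z ∈ nbhd G A m, G.Adj z y}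

lemma nbhd_comap (g : G ≃g G) (A : Set V) (m : ℕ) :
    nbhd G (g ⁻¹' A) m = g ⁻¹' nbhd G A m := by
  induction m with
  | zero => rfl
  | succ m ih =>
    ext y
    refine or_congr (by rw [ih]; rfl) ?_
    refine Iff.trans ?_ g.surjective.exists.symm
    rw [ih]
    exact exists_congr fun z => and_congr Iff.rfl g.map_adj_iff.symm

lemma MeasurableRandomSet.nbhd [Countable V] {Ω : Type*} [MeasurableSpace Ω] {A : Ω → Set V}
    (hA : MeasurableRandomSet A) (G : SimpleGraph V) (m : ℕ) :
    MeasurableRandomSet fun ω => Percolation.nbhd G (A ω) m := by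
  induction m with
  | zero => exact hA
  | succ m ih =>
    exact fun a => (ih a).or (Measurable.exists fun z => (ih z).and measurable_const)

lemma exists_mem_nbhd (hG : G.Connected) {A : Set V} (hA : A.Nonempty) (x : V) :
    ∃ m, x ∈ nbhd G A m := by
  obtain ⟨a, ha⟩ := hA
  refine reachable_induction (P := fun x => ∃ m, x ∈ nbhd G A m) ⟨0, ha⟩ ?_
    (hG.preconnected a x)
  rintro y z - ⟨m, hm⟩ hyz
  exact ⟨m + 1, Or.inr ⟨y, hm, hyz⟩⟩

/-- The union of two configurations. -/
def union (G : SimpleGraph V) (ω η : Config G) : Config G := fun e => ω e || η e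

lemma measurable_union (G : SimpleGraph V) :
    Measurable fun q : Config G × Config G => union G q.1 q.2 := by
  have hm : Measurable (fun q : Bool × Bool => q.1 || q.2) := measurable_of_finite _
  exact measurable_pi_lambda _ fun e => hm.comp (g := fun q : Bool × Bool => q.1 || q.2)
    (f := fun q : Config G × Config G => (q.1 e, q.2 e)) (by fun_prop)

lemma MeasurableGraph.comp {Ω Ω' : Type*} [MeasurableSpace Ω] [MeasurableSpace Ω']
    {H : Ω → SimpleGraph V} (hH : MeasurableGraph H) {f : Ω' → Ω} (hf : Measurable f) :
    MeasurableGraph fun ω => H (f ω) := fun a b => (hH a b).comp hf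

lemma measurableGraph_union (G : SimpleGraph V) :
    MeasurableGraph fun q : Config G × Config G => openGraph G (union G q.1 q.2) :=
  (measurableGraph_openGraph G).comp (measurable_union G)

lemma openGraph_le_union (G : SimpleGraph V) (ω η : Config G) :
    openGraph G ω ≤ openGraph G (union G ω η) := fun _ _ h => ⟨h.1, by simp [union, h.2]⟩

/-- Sprinkling: an infinite cluster with infinitely many points next to `J` has infinitely many
points in `J`. -/
lemma ae_infinite_inter_of_sprinkling [Countable V] (hlf : ∀ v, (G.neighborSet v).Finite)
    (r : G.edgeSet → I) {s : ℝ} (hs : 0 < s) (hr : ∀ e, s ≤ r e) (ω : Config G) (J : Set V) :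
    ∀ᵐ η ∂(bondMeasure G r), ∀ v,
      (component (openGraph G (union G ω η)) v ∩ nbhd G J 1).Infinite →
        (component (openGraph G (union G ω η)) v ∩ J).Infinite := by
  set H : Config G → SimpleGraph V := fun η => openGraph G (union G ω η) with hHdef
  have hH : MeasurableGraph H := (measurableGraph_union G).comp
    (f := fun η => (ω, η)) (by fun_prop)
  have hlfH : ∀ η v, ((H η).neighborSet v).Finite := fun η v =>
    (hlf v).subset fun y hy => hy.1
  have hA : MeasurableGraph fun η => avoid (H η) J := hH.avoid (measurableRandomSet_const J)
  -- The graph with `J` removed does not depend on the edges touching `J`. These can be resampled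
  -- after its components are known.
  let T : Set G.edgeSet := {e | ∃ j ∈ J, j ∈ (e : Sym2 V)}
  -- The finite set `F` is deterministic so that only countably many cases arise. At the end it is
  -- taken to be the supposedly finite intersection of the cluster with `J`.
  have hstep : ∀ u, ∀ F : Finset V, ∀ᵐ η ∂(bondMeasure G r), u ∉ J →
      (component (avoid (H η) J) u ∩ nbhd G J 1).Infinite →
      ∃ z ∈ component (avoid (H η) J) u, ∃ j ∈ J, j ∉ F ∧ (H η).Adj z j := by
    intro u F
    set P : Config G → Prop := fun η => u ∉ J →
      (component (avoid (H η) J) u ∩ nbhd G J 1).Infinite →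
      ∃ z ∈ component (avoid (H η) J) u, ∃ j ∈ J, j ∉ F ∧ (H η).Adj z j with hP
    have hPm : MeasurableSet {η | P η} := measurableSet_setOfPred.2 <|
      measurable_const.imp (((hA.component u).inter (measurableRandomSet_const _)).infinite.imp
        (Measurable.exists fun z => (hA.component u z).and (Measurable.exists fun j =>
          measurable_const.and (measurable_const.and (hH z j)))))
    have hmix : MeasurePreserving (fun q : Config G × Config G => mix T q.1 q.2)
        ((bondMeasure G r).prod (bondMeasure G r)) (bondMeasure G r) :=
      measurePreserving_mix (fun e => bernoulliMeasure true false (r e)) T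
    have h1 : ∀ᵐ q ∂((bondMeasure G r).prod (bondMeasure G r)), P (mix T q.1 q.2) := by
      refine (Measure.ae_prod_iff_ae_ae (p := fun q => P (mix T q.1 q.2))
        (measurable_mix T hPm)).2 ?_
      refine Filter.Eventually.of_forall fun η₁ => ?_
      have hav : ∀ η₂, avoid (H (mix T η₁ η₂)) J = avoid (H η₁) J := by
        intro η₂
        ext a b
        refine and_congr_left fun hab => exists_congr fun h => ?_
        have : (⟨s(a, b), h⟩ : G.edgeSet) ∉ T := by
          rintro ⟨j, hj, hje⟩
          rcases Sym2.mem_iff.1 hje with rfl | rfl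
          · exact hab.1 hj
          · exact hab.2 hj
        simp only [union, mix, if_neg this]
      by_cases hu : u ∈ J
      · exact Filter.Eventually.of_forall fun η₂ h => absurd hu h
      by_cases hinf : (component (avoid (H η₁) J) u ∩ nbhd G J 1).Infinite
      swap
      · refine Filter.Eventually.of_forall fun η₂ _ h => ?_
        rw [hav] at h
        exact absurd h hinf
      set C := component (avoid (H η₁) J) u with hC
      set E : Set G.edgeSet := {e | ∃ z ∈ C, ∃ j ∈ J, j ∉ F ∧ (e : Sym2 V) = s(z, j)} with hE
      -- Each vertex of `J` has finite degree, so infinitely many points next to `J` supply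
      -- infinitely many edges towards `J` even with the endpoints in `F` excluded.
      have hEinf : E.Infinite := by
        intro hfin
        refine hinf (((F.finite_toSet.biUnion fun j _ => hlf j).union
          (hfin.biUnion (t := fun e => {v | v ∈ (e : Sym2 V)}) fun e _ => ?_)).subset ?_)
        · classical
          refine ((e : Sym2 V).toFinset.finite_toSet).subset fun v hv => ?_
          exact Finset.mem_coe.2 (Sym2.mem_toFinset.2 hv)
        · rintro z ⟨hzC, hz⟩
          have hzJ : z ∉ J := notMem_of_reachable_avoid hzC hu
          rcases hz with hz | ⟨j, hj, hjz⟩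
          · exact absurd hz hzJ
          by_cases hjF : j ∈ F
          · exact Or.inl (Set.mem_biUnion (Finset.mem_coe.2 hjF) hjz)
          · refine Or.inr (Set.mem_biUnion (x := (⟨s(z, j), hjz.symm⟩ : G.edgeSet))
              ⟨z, hzC, j, hj, hjF, rfl⟩ (Sym2.mem_mk_left z j))
      filter_upwards [ae_exists_true r hs hr hEinf] with η₂ hη₂ _ _
      obtain ⟨⟨e, he⟩, ⟨z, hz, j, hj, hjF, rfl⟩, htrue⟩ := hη₂
      refine ⟨z, by rw [hav]; exact hz, j, hj, hjF, he, ?_⟩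
      have hmem : (⟨s(z, j), he⟩ : G.edgeSet) ∈ T := ⟨j, hj, Sym2.mem_mk_right z j⟩
      simp only [union, mix, if_pos hmem, htrue, Bool.or_true]
    have h2 := (ae_map_iff hmix.measurable.aemeasurable hPm).2 h1
    rwa [hmix.map_eq] at h2
  have hall : ∀ᵐ η ∂(bondMeasure G r), ∀ u, ∀ F : Finset V, u ∉ J →
      (component (avoid (H η) J) u ∩ nbhd G J 1).Infinite →
      ∃ z ∈ component (avoid (H η) J) u, ∃ j ∈ J, j ∉ F ∧ (H η).Adj z j := by
    simp only [ae_all_iff] at hstep ⊢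
    exact hstep
  filter_upwards [hall] with η hη v hv hfin
  obtain ⟨u, hu, huJ, -, huinf⟩ := exists_infinite_component_avoid (hlfH η) hv hfin
  obtain ⟨z, hz, j, hj, hjF, hzj⟩ := hη u hfin.toFinset huJ huinf
  refine hjF (hfin.mem_toFinset.2 ⟨?_, hj⟩)
  exact SimpleGraph.Reachable.trans hu
    ((SimpleGraph.Reachable.mono (avoid_le _ _) hz).trans hzj.reachable)

end Percolation

/-! ### Coupling of two parameter pairs and persistence of uniqueness -/

namespace Percolation

universe u

variable {V : Type u} {G : SimpleGraph V} {S : Set V}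

/-- The probability with which a closed edge of density `a` has to be sprinkled to reach
density `c`. -/
noncomputable def sprinkle (a c : I) (h : a < c) : I :=
  ⟨(c - a : ℝ) / (1 - a), by
    have h1 : (a : ℝ) < c := h
    have h2 : (c : ℝ) ≤ 1 := c.2.2
    constructor
    · exact div_nonneg (by linarith) (by linarith)
    · rw [div_le_one (by linarith)]; linarith⟩

lemma sprinkle_pos {a c : I} (h : a < c) : (0 : ℝ) < sprinkle a c h := by
  have h1 : (a : ℝ) < c := h
  have h2 : (c : ℝ) ≤ 1 := c.2.2
  exact div_pos (by linarith) (by linarith)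

lemma one_sub_sprinkle {a c : I} (h : a < c) :
    (1 - (c : ℝ)) = (1 - a) * (1 - sprinkle a c h) := by
  have h1 : (a : ℝ) < c := h
  have h2 : (c : ℝ) ≤ 1 := c.2.2
  have h3 : (1 - a : ℝ) ≠ 0 := by
    have : (0 : ℝ) < 1 - a := by linarith
    exact this.ne'
  change (1 - (c : ℝ)) = (1 - a) * (1 - (c - a : ℝ) / (1 - a))
  field_simp
  ring

lemma measurePreserving_union {p₀ q₀ p q : I} (hp : p₀ < p) (hq : q₀ < q) :
    MeasurePreserving (fun z : Config G × Config G => union G z.1 z.2)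
      ((inhomMeasure G S p₀ q₀).prod
        (bondMeasure G (rate G S (sprinkle p₀ p hp) (sprinkle q₀ q hq))))
      (inhomMeasure G S p q) := by
  refine measurePreserving_or (rate G S p₀ q₀) (rate G S (sprinkle p₀ p hp) (sprinkle q₀ q hq))
    (rate G S p q) fun e => ?_
  unfold rate
  split_ifs
  · exact one_sub_sprinkle hq
  · exact one_sub_sprinkle hp

/-- The vertices in infinite components. -/
def infiniteSet (H : SimpleGraph V) : Set V := {v | (component H v).Infinite}

/-- Monotonicity of uniqueness in both edge densities. -/
lemma ae_hasUniqueInfinite_of_lt [Countable V] (hG : G.Connected)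
    (hlf : ∀ v, (G.neighborSet v).Finite) (hS : (G.induce S).Connected)
    (hT : TransitiveOn G S) (ham : IsAmenable (G.induce S)) {p₀ q₀ p q : I}
    (hp : p₀ < p) (hq : q₀ < q)
    (huniq : ∀ᵐ ω ∂(inhomMeasure G S p₀ q₀), HasUniqueInfinite (openGraph G ω))
    (hinf : ∀ᵐ ω ∂(inhomMeasure G S p q), ∀ v, (component (openGraph G ω) v).Infinite →
      (component (openGraph G ω) v ∩ S).Infinite) :
    ∀ᵐ ω ∂(inhomMeasure G S p q), HasUniqueInfinite (openGraph G ω) := by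
  set r := rate G S (sprinkle p₀ p hp) (sprinkle q₀ q hq) with hr
  set s : ℝ := min (sprinkle p₀ p hp) (sprinkle q₀ q hq) with hs
  have hs0 : 0 < s := lt_min (sprinkle_pos hp) (sprinkle_pos hq)
  have hrs : ∀ e, s ≤ r e := by
    intro e
    rw [hr]
    unfold rate
    split_ifs
    · exact min_le_right _ _
    · exact min_le_left _ _
  set P := (inhomMeasure G S p₀ q₀).prod (bondMeasure G r) with hPdef
  have hmp : MeasurePreserving (fun z : Config G × Config G => union G z.1 z.2) P
      (inhomMeasure G S p q) := measurePreserving_union hp hq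
  have hmO := measurableGraph_openGraph G
  have hm1 : MeasurableGraph fun z : Config G × Config G => openGraph G z.1 :=
    hmO.comp measurable_fst
  have hm2 := measurableGraph_union G
  have hmI : MeasurableRandomSet fun z : Config G × Config G => infiniteSet (openGraph G z.1) :=
    fun v => hm1.infinite v
  have hmN : ∀ m, MeasurableRandomSet fun z : Config G × Config G =>
      nbhd G (infiniteSet (openGraph G z.1)) m := fun m => hmI.nbhd G m
  have h1 : ∀ᵐ z ∂P, HasUniqueInfinite (openGraph G z.1) :=
    Measure.quasiMeasurePreserving_fst.ae huniq
  have h2 := hmp.quasiMeasurePreserving.ae hinf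
  have h3 : ∀ᵐ z ∂P, ∀ m, ∀ x ∈ S, (component (openGraph G (union G z.1 z.2)) x ∩ S).Infinite →
      x ∈ nbhd G (infiniteSet (openGraph G z.1)) m →
      (component (openGraph G (union G z.1 z.2)) x ∩
        (nbhd G (infiniteSet (openGraph G z.1)) m ∩ S)).Infinite := by
    rw [ae_all_iff]
    intro m
    refine ae_infinite_inter_of_mem hlf hS hT ham (fun g => Prod.map (act g) (act g))
      (fun g hg => (measurePreserving_act g _ (rate_map hg p₀ q₀)).prod
        (measurePreserving_act g _ (rate_map hg _ _))) hm2 (fun g _ z => ?_) (hmN m)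
      (fun g _ z => ?_)
    · exact openGraph_act g (union G z.1 z.2)
    · have : infiniteSet (openGraph G (act g z.1)) = g ⁻¹' infiniteSet (openGraph G z.1) := by
        ext v
        simp only [infiniteSet, Set.mem_ofPred_eq, Set.mem_preimage]
        rw [openGraph_act, component_comap, infinite_preimage_iff]
      exact (congrArg (fun A => nbhd G A m) this).trans (nbhd_comap g _ m)
  have h4 : ∀ᵐ z ∂P, ∀ m v, (component (openGraph G (union G z.1 z.2)) v ∩
      nbhd G (infiniteSet (openGraph G z.1)) (m + 1)).Infinite →
      (component (openGraph G (union G z.1 z.2)) v ∩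
        nbhd G (infiniteSet (openGraph G z.1)) m).Infinite := by
    rw [ae_all_iff]
    intro m
    have hmeas : MeasurableSet {z : Config G × Config G | ∀ v,
        (component (openGraph G (union G z.1 z.2)) v ∩
          nbhd G (infiniteSet (openGraph G z.1)) (m + 1)).Infinite →
        (component (openGraph G (union G z.1 z.2)) v ∩
          nbhd G (infiniteSet (openGraph G z.1)) m).Infinite} :=
      measurableSet_setOfPred.2 <| Measurable.forall fun v =>
        ((hm2.component v).inter (hmN (m + 1))).infinite.imp
          ((hm2.component v).inter (hmN m)).infinite
    -- With the old configuration fixed, its neighbourhood of radius m is a deterministic set `J`,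
    -- and the neighbourhood of radius m + 1 is `nbhd G J 1`.
    refine (Measure.ae_prod_iff_ae_ae hmeas).2 (Filter.Eventually.of_forall fun ω => ?_)
    exact ae_infinite_inter_of_sprinkling hlf r hs0 hrs ω
      (nbhd G (infiniteSet (openGraph G ω)) m)
  have hfinal : ∀ᵐ z ∂P, HasUniqueInfinite (openGraph G (union G z.1 z.2)) := by
    filter_upwards [h1, h2, h3, h4] with z ⟨⟨v₀, hv₀⟩, hu⟩ h2 h3 h4
    set H := openGraph G z.1
    set H' := openGraph G (union G z.1 z.2)
    have hle : H ≤ H' := openGraph_le_union G z.1 z.2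
    -- The new cluster has infinitely many points within some distance m of the old infinite
    -- cluster. Descending to m = 0, it meets that cluster, whose points all connect to v₀.
    have key : ∀ v, (component H' v).Infinite → H'.Reachable v v₀ := by
      intro v hv
      obtain ⟨x, hvx, hxS⟩ := (h2 v hv).nonempty
      have hx : (component H' x ∩ S).Infinite := by
        rw [← component_eq hvx]; exact h2 v hv
      obtain ⟨m, hm⟩ := exists_mem_nbhd hG (A := infiniteSet H) ⟨v₀, hv₀⟩ x
      have hxm : (component H' x ∩ nbhd G (infiniteSet H) m).Infinite :=
        (h3 m x hxS hx hm).mono fun y hy => ⟨hy.1, hy.2.1⟩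
      have hdesc : ∀ m, (component H' x ∩ nbhd G (infiniteSet H) m).Infinite →
          (component H' x ∩ infiniteSet H).Infinite := by
        intro m
        induction m with
        | zero => exact id
        | succ m ih => exact fun h => ih (h4 m x h)
      obtain ⟨w, hxw, hw⟩ := (hdesc m hxm).nonempty
      exact SimpleGraph.Reachable.trans hvx
        (SimpleGraph.Reachable.trans hxw ((hu w v₀ hw hv₀).mono hle))
    exact ⟨⟨v₀, Set.Infinite.mono (component_mono hle v₀) hv₀⟩,
      fun a b ha hb => (key a ha).trans (key b hb).symm⟩
  have hback := (ae_map_iff hmp.measurable.aemeasurable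
    (measurableSet_setOfPred.2 hmO.hasUniqueInfinite)).2 hfinal
  rwa [hmp.map_eq] at hback

lemma numInfiniteClusters_eq_one {ω : Config G} (h : HasUniqueInfinite (openGraph G ω)) :
    numInfiniteClusters G ω = 1 := by
  obtain ⟨⟨v, hv⟩, hu⟩ := h
  refine Set.encard_eq_one.2 ⟨cluster G ω v, ?_⟩
  ext C
  constructor
  · rintro ⟨hC, w, rfl⟩
    exact component_eq (hu w v hC hv)
  · rintro rfl
    exact ⟨hv, v, rfl⟩

lemma natCast_mul_lt_one {d : ℕ} {p : I} (hp : p < 1) (hpd : p ≤ invSq d) : (d : ℝ) * p < 1 := by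
  have h1 : (p : ℝ) < 1 := hp
  have h2 : (p : ℝ) ≤ ((d : ℝ) ^ 2)⁻¹ := hpd
  rcases Nat.lt_or_ge d 2 with hd | hd
  · have hd' : (d : ℝ) ≤ 1 := by exact_mod_cast Nat.lt_succ_iff.1 hd
    have h0 : (0 : ℝ) ≤ p := p.2.1
    nlinarith
  · have hd' : (2 : ℝ) ≤ d := by exact_mod_cast hd
    calc (d : ℝ) * p ≤ d * ((d : ℝ) ^ 2)⁻¹ := by gcongr
      _ = 1 / d := by field_simp
      _ < 1 := by rw [div_lt_one (by linarith)]; linarith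

/-- Density 1 exceeds the critical value, so some configuration on `S` has an infinite cluster. The
zero-one law needs `S` to be infinite. -/
lemma infinite_of_critProb_lt_one {o : S} (h : critProb (G.induce S) o < 1) : S.Infinite := by
  have hne : bondMeasure (G.induce S) (fun _ => 1) (percolates (G.induce S) o) ≠ 0 := by
    intro h0
    exact absurd (le_sSup (α := I) (a := 1)
      (s := {p : I | bondMeasure (G.induce S) (fun _ => p) (percolates (G.induce S) o) = 0}) h0)
      (not_le.2 h)
  obtain ⟨ω, hω⟩ := nonempty_of_measure_ne_zero hne
  exact Set.infinite_coe_iff.1 (Set.infinite_univ_iff.1 (Set.Infinite.mono (Set.subset_univ _) hω))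

end Percolation

theorem mainTheorem6 {V : Type*} (G : SimpleGraph V) [G.LocallyFinite] (hG : G.Connected)
    (d : ℕ) (hd : IsLUB (Set.range fun v : V => G.degree v) d)
    (Γ : Subgroup (G ≃g G)) (S : Set V) (hS : (G.induce S).Connected)
    (hΓ : Percolation.ActsTransitivelyOn Γ S)
    (hamen : Percolation.IsAmenable (G.induce S))
    (o : S)
    (hpc_pos : 0 < Percolation.critProb (G.induce S) o)
    (hpc_lt : Percolation.critProb (G.induce S) o < 1)
    (p q : unitInterval) (hp_pos : 0 < p) (hp_lt : p < 1)
    (hq : Percolation.critFun G S o (Percolation.invSq d) < q)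
    (hperc : ∃ v : V, 0 < Percolation.inhomMeasure G S p q (Percolation.percolates G v))
    (hinf : ∀ v : V, Percolation.inhomMeasure G S p q
      {ω | (Percolation.cluster G ω v).Infinite ∧ (Percolation.cluster G ω v ∩ S).Finite} = 0) :
    ∀ᵐ ω ∂(Percolation.inhomMeasure G S p q), Percolation.numInfiniteClusters G ω = 1 := by
  open Percolation in
  have hlf : ∀ v, (G.neighborSet v).Finite := fun v => Set.toFinite _
  have hV : Countable V := countable_of_connected hG hlf
  have hSinf : S.Infinite := infinite_of_critProb_lt_one hpc_lt
  have hT : TransitiveOn G S := hΓ.transitiveOn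
  have hdeg : ∀ v, G.degree v ≤ d := fun v => hd.1 ⟨v, rfl⟩
  suffices h : ∀ᵐ ω ∂(inhomMeasure G S p q), HasUniqueInfinite (openGraph G ω) by
    filter_upwards [h] with ω hω using numInfiniteClusters_eq_one hω
  rcases le_or_gt p (invSq d) with hpd | hpd
  · have hq0 : 0 < q := lt_of_le_of_lt unitInterval.nonneg' hq
    obtain ⟨v, hv⟩ := hperc
    exact ae_hasUniqueInfinite_of_finite_off hG hlf hS hSinf hT hamen hq0
      (ae_finite_offGraph_component hdeg S p q (natCast_mul_lt_one hp_lt hpd)) ⟨v, hv.ne'⟩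
  -- A strict gap below q keeps the sprinkling density positive on E_S, while q₀ above the supremum
  -- forces percolation at (d⁻², q₀).
  · obtain ⟨q₀, hq₀, hq₀q⟩ := exists_between hq
    have hq0 : 0 < q₀ := lt_of_le_of_lt unitInterval.nonneg' hq₀
    have hperc₀ : inhomMeasure G S (invSq d) q₀ (percolates G o) ≠ 0 := fun h0 =>
      absurd (le_sSup (α := unitInterval)
        (s := {q | inhomMeasure G S (invSq d) q (percolates G o) = 0}) h0) (not_le.2 hq₀)
    have huniq := ae_hasUniqueInfinite_of_finite_off hG hlf hS hSinf hT hamen hq0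
      (ae_finite_offGraph_component hdeg S (invSq d) q₀
        (natCast_mul_lt_one (hpd.trans hp_lt) le_rfl)) ⟨o, hperc₀⟩
    refine ae_hasUniqueInfinite_of_lt hG hlf hS hT hamen hpd hq₀q huniq (ae_all_iff.2 fun v => ?_)
    have := hinf v
    refine (ae_iff (p := fun ω => (component (openGraph G ω) v).Infinite →
      (component (openGraph G ω) v ∩ S).Infinite)).2 (measure_mono_null ?_ this)
    intro ω hω
    simp only [Set.mem_ofPred_eq, Classical.not_imp, Set.not_infinite] at hω
    exact hω
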